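/- Conventions. All rings are associative and unital, not necessarily commutative; modules are left modules; chain complexes are $\mathbb{Z}$-indexed; $(\Sigma X)_j=X_{j-1}$ with differential $-\partial^X$; and $\mathrm{Cone}(f)_j=X_{j-1}\oplus Y_j$ with differential $(x,y)\mapsto(-\partial x,\partial y+f(x))$ for a chain map $f\colon X\to Y$. A class of groups is always closed under isomorphisms. An is-class of groups is a class of groups that is also closed under taking subgroups. Bootstrappable properties. For a ring $A$, a bootstrappable property of $A$-chain complexes is a sequence $(\mathsf{B}_n)_{n\in\mathbb{Z}}$ of classes of $A$-chain complexes, closed under isomorphisms, such that for all $n\in\mathbb{N}=\{0,1,2,\dots\}$ and all $A$-chain complexes $X,Y$: (a) if $X$ is concentrated in degrees $\ge 0$, then $X\in\mathsf{B}_m$ for all $m<0$; (b) $X\in\mathsf{B}_n$ if and only if $\Sigma X\in\mathsf{B}_{n+1}$; (c) if $f\colon X\to Y$ is a chain map, $X\in\mathsf{B}_{n-1}$ and $Y\in\mathsf{B}_n$, then $\mathrm{Cone}(f)\in\mathsf{B}_n$. Let $R$ be a ring and let $\mathcal{C}$ be an is-class of groups. An equivariantly bootstrappable property of $R[\mathcal{C}]$-chain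 complexes is a family $(\mathsf{B}^\Gamma_n)_{\Gamma\in\mathcal{C},\,n\in\mathbb{Z}}$, where $\mathsf{B}^\Gamma_*$ is a bootstrappable property of $R\Gamma$-chain complexes for every $\Gamma\in\mathcal{C}$, such that for all $n\in\mathbb{Z}$, all $\Gamma\in\mathcal{C}$, all subgroups $\Delta\le\Gamma$ and all $X\in\mathsf{B}^\Delta_n$ one has $R\Gamma\otimes_{R\Delta}X\in\mathsf{B}^\Gamma_n$. A bootstrappable property of $\mathcal{C}$ over $R$ is a sequence $\mathsf{B}_*=(\mathsf{B}_n)_{n\in\mathbb{Z}}$ of classes of groups for which there is an equivariantly bootstrappable property $(\mathsf{B}^\Gamma_n)$ of $R[\mathcal{C}]$-chain complexes such that, for every $n\in\mathbb{Z}$, $\mathsf{B}_n$ consists of those $\Gamma\in\mathcal{C}$ for which the trivial $R\Gamma$-module $R$ has a projective resolution lying in $\mathsf{B}^\Gamma_n$. A group $\Gamma$ is of type $\mathsf{FP}_n(R)$ if the trivial $R\Gamma$-module $R$ has a projective resolution $P$ with $P_j$ finitely generated over $R\Gamma$ for all $j\le n$. Theorem. Let $\mathsf{B}_*$ be a bootstrappable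 property of an is-class $\mathcal{C}$ of groups over a ring $R$. For all $n\in\mathbb{Z}$ the following hold. (i) Let $\Gamma\in\mathcal{C}$ be (isomorphic to) the fundamental group of a graph of groups on a finite, non-empty, connected graph. If all vertex groups lie in $\mathsf{B}_n$ and all edge groups lie in $\mathsf{B}_{n-1}$, then $\Gamma\in\mathsf{B}_n$. (ii) Let $\Gamma\in\mathcal{C}$ and let $N$ be a normal subgroup of $\Gamma$ such that $\Gamma/N$ is of type $\mathsf{FP}_n(R)$. If $N\in\mathsf{B}_m$ for all $m\le n$, then $\Gamma\in\mathsf{B}_n$. (The condition on $\Gamma/N$ is satisfied whenever $\Gamma$ is of type $\mathsf{FP}_n(R)$ and $N$ is of type $\mathsf{FP}_{n-1}(R)$.) (iii) Let $\Gamma\in\mathcal{C}$ and let $N$ be a finite index normal subgroup of $\Gamma$. If $N\in\mathsf{B}_m$ for all $m\le n$, then $\Gamma\in\mathsf{B}_n$. (iv) Let $\Gamma\in\mathcal{C}$ be a non-trivial finitely generated free abelian group. If $\mathbb{Z}\in\mathsf{B}_m$ for all $m\le n$, then $\Gamma\in\mathsf{B}_n$. (v) Let $\Gamma\in\mathcal{C}$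 be a group of type $\mathsf{FP}_n(R)$ containing a non-trivial finitely generated free abelian normal subgroup. If $\mathbb{Z}\in\mathsf{B}_m$ for all $m\le n$, then $\Gamma\in\mathsf{B}_n$. -/

import Mathlib

open CategoryTheory

universe u v w

noncomputable section

/-! ## Chain complexes over a (not necessarily commutative) ring -/

/-- The suspension `ΣX` of a `ℤ`-indexed chain complex: `(ΣX)_j = X_{j-1}`, with differential `-∂`. -/
def suspension {A : Type u} [Ring A] (X : ChainComplex (ModuleCat.{u} A) ℤ) :
    ChainComplex (ModuleCat.{u} A) ℤ where
  X j := X.X (j - 1)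
  d i j := -X.d (i - 1) (j - 1)
  shape i j h := by
    rw [X.shape, neg_zero]
    simp only [ComplexShape.down_Rel] at h ⊢
    omega
  d_comp_d' i j k _ _ := by simp

/-- The mapping cone of a chain map: `Cone(f)_j = X_{j-1} ⊕ Y_j`, with differential
`(x, y) ↦ (-∂x, ∂y + f x)`. -/
abbrev mappingCone {A : Type u} [Ring A] {X Y : ChainComplex (ModuleCat.{u} A) ℤ} (f : X ⟶ Y) :
    ChainComplex (ModuleCat.{u} A) ℤ :=
  HomologicalComplex.homotopyCofiber f

/-- `X` is concentrated in degrees `≥ 0`. -/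
def ConcentratedInNonnegDegrees {A : Type u} [Ring A] (X : ChainComplex (ModuleCat.{u} A) ℤ) :
    Prop :=
  ∀ j : ℤ, j < 0 → Limits.IsZero (X.X j)

/-- A bootstrappable property of `A`-chain complexes: a sequence of classes of chain complexes,
closed under isomorphisms, satisfying the degree, suspension and mapping cone axioms. -/
structure IsBootstrappable {A : Type u} [Ring A]
    (B : ℤ → ChainComplex (ModuleCat.{u} A) ℤ → Prop) : Prop where
  of_iso : ∀ (n : ℤ) (X Y : ChainComplex (ModuleCat.{u} A) ℤ), Nonempty (X ≅ Y) → B n X → B n Y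
  degree : ∀ X : ChainComplex (ModuleCat.{u} A) ℤ, ConcentratedInNonnegDegrees X →
    ∀ m : ℤ, m < 0 → B m X
  suspension_iff : ∀ (n : ℕ) (X : ChainComplex (ModuleCat.{u} A) ℤ),
    B (n : ℤ) X ↔ B ((n : ℤ) + 1) (suspension X)
  cone : ∀ (n : ℕ) (X Y : ChainComplex (ModuleCat.{u} A) ℤ) (f : X ⟶ Y),
    B ((n : ℤ) - 1) X → B (n : ℤ) Y → B (n : ℤ) (mappingCone f)

/-- `P` is a projective resolution of the module `M`: the chain modules are projective, vanish
in negative degrees, and the homology is `M` in degree `0` and zero elsewhere. -/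
structure IsProjectiveResolution {A : Type u} [Ring A] (P : ChainComplex (ModuleCat.{u} A) ℤ)
    (M : ModuleCat.{u} A) : Prop where
  projective : ∀ j : ℤ, Module.Projective A (P.X j)
  nonneg : ConcentratedInNonnegDegrees P
  exact : ∀ j : ℤ, j ≠ 0 → P.ExactAt j
  homology_zero : Nonempty (P.homology 0 ≅ M)

/-! ## Extension of scalars `A ⊗_S M` along a homomorphism of noncommutative rings

`A ⊗_S M` is the quotient of `A ⊗_ℤ M` by the relations `a f(s) ⊗ m = a ⊗ s m`. -/

section Induction

open TensorProduct

variable {S A : Type u} [Ring S] [Ring A] (f : S →+* A)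

/-- The submodule of `A ⊗_ℤ M` generated by the elements `a f(s) ⊗ m - a ⊗ s m`. -/
def balancedRelations (M : Type u) [AddCommGroup M] [Module S M] : Submodule A (A ⊗[ℤ] M) :=
  Submodule.span A
    {x | ∃ (a : A) (s : S) (m : M), x = (a * f s) ⊗ₜ[ℤ] m - a ⊗ₜ[ℤ] (s • m)}

/-- The map `A ⊗_ℤ M → A ⊗_ℤ N`, `a ⊗ m ↦ a ⊗ g m`. -/
def tensorMapInt {M N : Type u} [AddCommGroup M] [AddCommGroup N] [Module S M] [Module S N]
    (g : M →ₗ[S] N) : A ⊗[ℤ] M →ₗ[A] A ⊗[ℤ] N :=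
  TensorProduct.AlgebraTensorModule.map LinearMap.id g.toAddMonoidHom.toIntLinearMap

theorem tensorMapInt_tmul {M N : Type u} [AddCommGroup M] [AddCommGroup N] [Module S M]
    [Module S N] (g : M →ₗ[S] N) (a : A) (m : M) :
    tensorMapInt g (a ⊗ₜ[ℤ] m) = a ⊗ₜ[ℤ] g m := rfl

theorem balancedRelations_le_comap {M N : Type u} [AddCommGroup M] [AddCommGroup N]
    [Module S M] [Module S N] (g : M →ₗ[S] N) :
    balancedRelations f M ≤ (balancedRelations f N).comap (tensorMapInt g) := by
  refine Submodule.span_le.2 ?_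
  rintro _ ⟨a, s, m, rfl⟩
  refine Submodule.subset_span ⟨a, s, g m, ?_⟩
  rw [map_sub, tensorMapInt_tmul, tensorMapInt_tmul, map_smul]

/-- The left `A`-module `A ⊗_S M`. -/
abbrev InducedModule (M : Type u) [AddCommGroup M] [Module S M] : Type u :=
  (A ⊗[ℤ] M) ⧸ balancedRelations f M

/-- The map `A ⊗_S M → A ⊗_S N`, `a ⊗ m ↦ a ⊗ g m`. -/
def inducedMap {M N : Type u} [AddCommGroup M] [AddCommGroup N] [Module S M] [Module S N]
    (g : M →ₗ[S] N) : InducedModule f M →ₗ[A] InducedModule f N :=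
  Submodule.mapQ _ _ (tensorMapInt g) (balancedRelations_le_comap f g)

theorem inducedMap_mk_tmul {M N : Type u} [AddCommGroup M] [AddCommGroup N] [Module S M]
    [Module S N] (g : M →ₗ[S] N) (a : A) (m : M) :
    inducedMap f g (Submodule.Quotient.mk (a ⊗ₜ[ℤ] m)) = Submodule.Quotient.mk (a ⊗ₜ[ℤ] g m) := rfl

theorem inducedModule_hom_ext {M : Type u} {L : Type u} [AddCommGroup M] [Module S M]
    [AddCommGroup L] [Module A L] {p q : InducedModule f M →ₗ[A] L}
    (h : ∀ (a : A) (m : M),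
      p (Submodule.Quotient.mk (a ⊗ₜ[ℤ] m)) = q (Submodule.Quotient.mk (a ⊗ₜ[ℤ] m))) :
    p = q := by
  refine LinearMap.ext fun x => ?_
  obtain ⟨x, rfl⟩ := Submodule.Quotient.mk_surjective _ x
  induction x using TensorProduct.induction_on with
  | zero => simp
  | tmul a m => exact h a m
  | add x y hx hy => rw [Submodule.Quotient.mk_add, map_add, map_add, hx, hy]

/-- The functor `M ↦ A ⊗_S M` from left `S`-modules to left `A`-modules. -/
def inductionFunctor : ModuleCat.{u} S ⥤ ModuleCat.{u} A where
  obj M := ModuleCat.of A (InducedModule f M)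
  map g := ModuleCat.ofHom (inducedMap f g.hom)
  map_id _ := ModuleCat.hom_ext (inducedModule_hom_ext f fun _ _ => rfl)
  map_comp _ _ := ModuleCat.hom_ext (inducedModule_hom_ext f fun _ _ => rfl)

instance inductionFunctor_additive : (inductionFunctor f).Additive where
  map_add {M N g h} := ModuleCat.hom_ext (inducedModule_hom_ext f fun a m => by
    change (Submodule.Quotient.mk (a ⊗ₜ[ℤ] (g.hom m + h.hom m)) : InducedModule f N) =
      Submodule.Quotient.mk (a ⊗ₜ[ℤ] g.hom m) + Submodule.Quotient.mk (a ⊗ₜ[ℤ] h.hom m)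
    rw [TensorProduct.tmul_add, Submodule.Quotient.mk_add])

/-- The degreewise extension of scalars of a chain complex. -/
def inducedComplex (X : ChainComplex (ModuleCat.{u} S) ℤ) : ChainComplex (ModuleCat.{u} A) ℤ :=
  ((inductionFunctor f).mapHomologicalComplex (ComplexShape.down ℤ)).obj X

end Induction

/-! ## Group rings -/

/-- The augmentation `RΓ → R`, sending every group element to `1`. -/
def augmentation (R Γ : Type u) [Ring R] [Group Γ] : MonoidAlgebra R Γ →+* R :=
  MonoidAlgebra.liftNCRingHom (RingHom.id R) (1 : Γ →* R) fun x _ => Commute.one_right x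

/-- The trivial left `RΓ`-module `R`. -/
def trivialModule (R Γ : Type u) [Ring R] [Group Γ] : ModuleCat.{u} (MonoidAlgebra R Γ) :=
  (ModuleCat.restrictScalars (augmentation R Γ)).obj (ModuleCat.of R R)

/-- The induction `RΓ ⊗_{RΔ} X` of an `RΔ`-chain complex to a group `Γ` containing `Δ`. -/
def groupInduction (R : Type u) [Ring R] {Γ : Type u} [Group Γ] (Δ : Subgroup Γ)
    (X : ChainComplex (ModuleCat.{u} (MonoidAlgebra R Δ)) ℤ) :
    ChainComplex (ModuleCat.{u} (MonoidAlgebra R Γ)) ℤ :=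
  inducedComplex (MonoidAlgebra.mapDomainRingHom R Δ.subtype) X

/-- `Γ` is of type `FP_n(R)`: the trivial module `R` has a projective resolution that is finitely
generated in all degrees `≤ n`. -/
def IsOfTypeFP (R : Type u) [Ring R] (n : ℤ) (Γ : Type u) [Group Γ] : Prop :=
  ∃ P : ChainComplex (ModuleCat.{u} (MonoidAlgebra R Γ)) ℤ,
    IsProjectiveResolution P (trivialModule R Γ) ∧
      ∀ j : ℤ, j ≤ n → Module.Finite (MonoidAlgebra R Γ) (P.X j)

/-! ## Classes of groups -/

/-- A class of groups, closed under isomorphisms. -/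
structure GroupClass where
  Mem : ∀ (Γ : Type u) [Group Γ], Prop
  of_mulEquiv : ∀ (Γ Γ' : Type u) [Group Γ] [Group Γ'], Nonempty (Γ ≃* Γ') → Mem Γ → Mem Γ'

/-- An is-class of groups: closed under isomorphisms and under taking subgroups. -/
structure ISClass extends GroupClass.{u} where
  of_subgroup : ∀ (Γ : Type u) [Group Γ] (Δ : Subgroup Γ), Mem Γ → Mem Δ

/-- An equivariantly bootstrappable property of `R[?]`-chain complexes, where `C` is the is-class
`?`. Only the values of `B` at groups in `C` matter. -/
structure IsEquivariantlyBootstrappable (R : Type u) [Ring R] (C : ISClass.{u})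
    (B : ∀ (Γ : Type u) [Group Γ], ℤ → ChainComplex (ModuleCat.{u} (MonoidAlgebra R Γ)) ℤ → Prop) :
    Prop where
  bootstrappable : ∀ (Γ : Type u) [Group Γ], C.Mem Γ → IsBootstrappable (B Γ)
  induction : ∀ (n : ℤ) (Γ : Type u) [Group Γ], C.Mem Γ → ∀ (Δ : Subgroup Γ)
    (X : ChainComplex (ModuleCat.{u} (MonoidAlgebra R Δ)) ℤ),
    B Δ n X → B Γ n (groupInduction R Δ X)

/-- A sequence `B` of classes of groups is a bootstrappable property of the is-class `C` over `R`
if it is associated to some equivariantly bootstrappable property `E`: the groups in `B n` are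
those `Γ` in `C` for which `R` has a projective `RΓ`-resolution lying in `E Γ n`. -/
def IsBootstrappableOfGroups (R : Type u) [Ring R] (C : ISClass.{u}) (B : ℤ → GroupClass.{u}) :
    Prop :=
  ∃ E : ∀ (Γ : Type u) [Group Γ], ℤ → ChainComplex (ModuleCat.{u} (MonoidAlgebra R Γ)) ℤ → Prop,
    IsEquivariantlyBootstrappable R C E ∧
      ∀ (n : ℤ) (Γ : Type u) [Group Γ], (B n).Mem Γ ↔
        C.Mem Γ ∧ ∃ P : ChainComplex (ModuleCat.{u} (MonoidAlgebra R Γ)) ℤ,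
          IsProjectiveResolution P (trivialModule R Γ) ∧ E Γ n P

/-- `Γ` is a finitely generated free abelian group. -/
def IsFGFreeAbelian (Γ : Type u) [Group Γ] : Prop :=
  ∃ k : ℕ, Nonempty (Γ ≃* Multiplicative (Fin k → ℤ))

/-! ## Graphs of groups -/

/-- A graph of groups on a non-empty connected graph (loops and multiple edges allowed) with
vertex set `V` and edge set `E`, each edge being given a reference orientation. -/
structure GraphOfGroups (V : Type v) (E : Type w) where
  src : E → V
  tgt : E → V
  nonempty : Nonempty V
  connected : ∀ x y : V, Relation.EqvGen (fun a b => ∃ e, src e = a ∧ tgt e = b) x y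
  vertexGroup : V → Type u
  edgeGroup : E → Type u
  [vertexGroupInst : ∀ x, Group (vertexGroup x)]
  [edgeGroupInst : ∀ e, Group (edgeGroup e)]
  srcHom : ∀ e, edgeGroup e →* vertexGroup (src e)
  tgtHom : ∀ e, edgeGroup e →* vertexGroup (tgt e)
  srcHom_injective : ∀ e, Function.Injective (srcHom e)
  tgtHom_injective : ∀ e, Function.Injective (tgtHom e)

namespace GraphOfGroups

attribute [instance] GraphOfGroups.vertexGroupInst GraphOfGroups.edgeGroupInst

variable {V : Type v} {E : Type w} (G : GraphOfGroups.{u, v, w} V E)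

/-- `x` and `y` are joined by an edge path using only edges in `T`. -/
def Joined (T : Set E) : V → V → Prop :=
  Relation.EqvGen fun a b => ∃ e ∈ T, G.src e = a ∧ G.tgt e = b

/-- `T` is the edge set of a maximal tree: it connects all vertices, and contains no circuit (the
endpoints of every edge of `T` are no longer joined after removing that edge). -/
structure IsMaximalTree (T : Set E) : Prop where
  joined : ∀ x y : V, G.Joined T x y
  acyclic : ∀ e ∈ T, ¬ G.Joined (T \ {e}) (G.src e) (G.tgt e)

/-- The free product of all vertex groups and of the free group on the edges. -/
abbrev FreeProd : Type (max u v w) :=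
  Monoid.Coprod (Monoid.CoprodI G.vertexGroup) (FreeGroup E)

/-- A vertex group element in the free product. -/
def vertexElem (x : V) (g : G.vertexGroup x) : G.FreeProd :=
  Monoid.Coprod.inl (Monoid.CoprodI.of g)

/-- The stable letter of an edge. -/
def edgeElem (e : E) : G.FreeProd :=
  Monoid.Coprod.inr (FreeGroup.of e)

/-- The relators `t_e · tgt(a) · t_e⁻¹ · src(a)⁻¹` for all edges `e` and `a` in the edge group
of `e`, and `t_e` for all `e` in `T`. -/
def relators (T : Set E) : Set G.FreeProd :=
  {x | ∃ (e : E) (a : G.edgeGroup e), x = G.edgeElem e * G.vertexElem (G.tgt e) (G.tgtHom e a) *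
    (G.edgeElem e)⁻¹ * (G.vertexElem (G.src e) (G.srcHom e a))⁻¹} ∪
  {x | ∃ e ∈ T, x = G.edgeElem e}

/-- The fundamental group of the graph of groups relative to a maximal tree `T`. -/
abbrev fundamentalGroup (T : Set E) : Type (max u v w) :=
  G.FreeProd ⧸ Subgroup.normalClosure (G.relators T)

end GraphOfGroups

end

/-! Everything is reduced to modules: for a ring `A` and a bootstrappable property `B`, the question
is which modules have a projective resolution in `B n`. If `0 → K → L → M → 0` is exact, the mapping
cone of a lift of `K → L` to resolutions resolves `M`. The cone axiom therefore turns `K` in degree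
`n - 1` and `L` in degree `n` into `M` in degree `n` (`IsBootstrappable.hasResolutionIn_of_exact`).
Finite non-empty direct sums are allowed too, because `Σ(X × Y)` is the cone of the zero map `X →
ΣY`. Since `RΓ` is free as a right `RΔ`-module, induction preserves projective resolutions, so the
permutation module `R[Γ/Δ]` inherits resolutions from the trivial module of `Δ`
(`hasResolutionIn_induced`).

For (i), the augmented chain complex of the Bass–Serre tree is a short exact sequence `0 → ⨁
R[Γ/Γ_e] → ⨁ R[Γ/Γ_v] → R → 0`, to which the cone argument applies. The tree itself is never built.
The vertex groups embed because `Γ` acts by permutations of a set so large that isomorphic subgroups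
act conjugately. Injectivity of the boundary map is tested against coinduced modules: cochains on
edges define an affine action of `Γ`, and this action has a fixed point because first cohomology
with coinduced coefficients vanishes (`exists_coboundary`).

For (ii), the trivial module over `R[Γ/N]` has a partial resolution by finitely generated free
modules. Restricted to `RΓ`, these are finite sums of `R[Γ/N]`, which is induced from `N`; dimension
shifting along the syzygies gives the claim. Being finitely generated up to degree `n` is itself an
equivariantly bootstrappable property, so the same machinery shows that extensions of groups of
finite type are of finite type, and a descent argument gives the criterion in (ii).

The rest are cases of (ii): finite quotients are of type `FP_n` for all `n`; a free abelian group of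
rank `k + 1` is an extension of one of rank `k` by an infinite cyclic group; and (v) combines the
criterion with (iv). -/

noncomputable section

/-! ## Projective resolutions, elementwise -/

section Resolutions

variable {A : Type u} [Ring A]

/-- `ε` augments the complex `P` to an exact sequence `⋯ → P₁ → P₀ → M → 0`. -/
structure IsAugmentation (P : ChainComplex (ModuleCat.{u} A) ℤ) {M : Type u} [AddCommGroup M]
    [Module A M] (ε : P.X 0 →ₗ[A] M) : Prop where
  surjective : Function.Surjective ε
  exact_zero : Function.Exact (P.d 1 0).hom ε
  exact : ∀ i j k : ℤ, j + 1 = i → k + 1 = j → 0 < j → Function.Exact (P.d i j).hom (P.d j k).hom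

theorem exactAt_iff_function_exact (P : ChainComplex (ModuleCat.{u} A) ℤ) {i j k : ℤ}
    (hij : j + 1 = i) (hjk : k + 1 = j) :
    P.ExactAt j ↔ Function.Exact (P.d i j).hom (P.d j k).hom := by
  rw [P.exactAt_iff' i j k ((ComplexShape.down ℤ).prev_eq' hij)
    ((ComplexShape.down ℤ).next_eq' hjk), ShortComplex.ShortExact.moduleCat_exact_iff_function_exact]
  rfl

theorem d_zero_eq_zero {P : ChainComplex (ModuleCat.{u} A) ℤ} (hP : ConcentratedInNonnegDegrees P)
    {i j : ℤ} (hj : j < 0) : P.d i j = 0 :=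
  (hP j hj).eq_of_tgt _ _

theorem ConcentratedInNonnegDegrees.apply_eq_zero {P : ChainComplex (ModuleCat.{u} A) ℤ}
    (hP : ConcentratedInNonnegDegrees P) {j : ℤ} (hj : j < 0) (x : P.X j) : x = 0 := by
  have : 𝟙 (P.X j) = 0 := (hP j hj).eq_of_tgt _ _
  have h := congrArg (fun f => f.hom x) this
  simpa using h

theorem isProjectiveResolution_of_isAugmentation {P : ChainComplex (ModuleCat.{u} A) ℤ}
    {M : ModuleCat.{u} A} (hproj : ∀ j : ℤ, 0 ≤ j → Module.Projective A (P.X j))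
    (hP : ConcentratedInNonnegDegrees P) {ε : P.X 0 →ₗ[A] M} (hε : IsAugmentation P ε) :
    IsProjectiveResolution P M where
  projective j := by
    rcases le_or_gt 0 j with h | h
    · exact hproj j h
    · have : Subsingleton (P.X j) := ⟨fun x y => by
        rw [hP.apply_eq_zero h x, hP.apply_eq_zero h y]⟩
      infer_instance
  nonneg := hP
  exact j hj := by
    rcases lt_or_gt_of_ne hj with h | h
    · exact ShortComplex.exact_of_isZero_X₂ _ (hP j h)
    · rw [exactAt_iff_function_exact P rfl (sub_add_cancel j 1)]
      exact hε.exact _ _ _ rfl (sub_add_cancel j 1) h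
  homology_zero := by
    have w : P.d 1 0 ≫ ModuleCat.ofHom ε = 0 :=
      ModuleCat.hom_ext (LinearMap.ext fun x => hε.exact_zero.apply_apply_eq_zero x)
    let S := ShortComplex.mk (P.d 1 0) (ModuleCat.ofHom ε) w
    have hS : S.Exact := (ShortComplex.ShortExact.moduleCat_exact_iff_function_exact S).2
      hε.exact_zero
    have : Epi S.g := (ModuleCat.epi_iff_surjective _).2 hε.surjective
    -- `M` and the opcycles in degree 0 are both cokernels of `P.d 1 0`. The homology in degree 0 is
    -- the opcycles because the differential out of degree 0 vanishes.
    have c1 := hS.gIsCokernel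
    have c2 := P.opcyclesIsCokernel 1 0 ((ComplexShape.down ℤ).prev_eq' (by simp))
    have hnext : (ComplexShape.down ℤ).next 0 = -1 := (ComplexShape.down ℤ).next_eq' (by simp)
    exact ⟨P.isoHomologyι 0 (-1) hnext (d_zero_eq_zero hP (by simp)) ≪≫
      c2.coconePointUniqueUpToIso c1⟩

theorem IsProjectiveResolution.exists_isAugmentation {P : ChainComplex (ModuleCat.{u} A) ℤ}
    {M : ModuleCat.{u} A} (h : IsProjectiveResolution P M) :
    ∃ ε : P.X 0 →ₗ[A] M, IsAugmentation P ε := by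
  obtain ⟨e⟩ := h.homology_zero
  have hnext : (ComplexShape.down ℤ).next 0 = -1 := (ComplexShape.down ℤ).next_eq' (by simp)
  have hprev : (ComplexShape.down ℤ).prev 0 = 1 := (ComplexShape.down ℤ).prev_eq' (by simp)
  let i := P.isoHomologyι 0 (-1) hnext (d_zero_eq_zero h.nonneg (by simp))
  let ε : P.X 0 ⟶ M := P.pOpcycles 0 ≫ i.inv ≫ e.hom
  have w : P.d 1 0 ≫ ε = 0 := by simp [ε]
  have hepi : Epi ε := inferInstance
  refine ⟨ε.hom, (ModuleCat.epi_iff_surjective ε).1 hepi, ?_, fun i j k hij hjk hj => ?_⟩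
  · have c : Limits.IsColimit (Limits.CokernelCofork.ofπ (f := P.d 1 0) ε w) :=
      Limits.IsColimit.ofIsoColimit (P.opcyclesIsCokernel 1 0 hprev)
        (Limits.Cofork.ext (i.symm ≪≫ e) (by simp [ε]))
    exact (ShortComplex.ShortExact.moduleCat_exact_iff_function_exact (ShortComplex.mk _ _ w)).1
      (ShortComplex.exact_of_g_is_cokernel _ c)
  · exact (exactAt_iff_function_exact P hij hjk).1 (h.exact j hj.ne')

end Resolutions

/-! ### Existence and comparison of projective resolutions -/

section Existence

variable {A : Type u} [Ring A]

/-- The embedding of the nonnegative degrees into all degrees. -/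
def embeddingNatInt : (ComplexShape.down ℕ).Embedding (ComplexShape.down ℤ) :=
  ComplexShape.Embedding.mk' _ _ (fun n => (n : ℤ)) (fun _ _ h => by simpa using h)
    (fun i j => by simp only [ComplexShape.down_Rel]; omega)

/-- An `ℕ`-indexed resolution is extended by zero. Existence matters for `n < 0`: there every
resolution lies in `B n`, but one has to be exhibited. -/
theorem exists_isProjectiveResolution (M : ModuleCat.{u} A) :
    ∃ P : ChainComplex (ModuleCat.{u} A) ℤ, IsProjectiveResolution P M := by
  let Q := projectiveResolution M
  have hneg : ∀ j : ℤ, j < 0 → ∀ i, embeddingNatInt.f i ≠ j := by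
    intro j hj i h
    change (i : ℤ) = j at h
    omega
  have h0 : ∀ j : ℤ, j < 0 → Limits.IsZero ((Q.complex.extend embeddingNatInt).X j) :=
    fun j hj => Q.complex.isZero_extend_X _ _ (hneg j hj)
  refine ⟨Q.complex.extend embeddingNatInt, ⟨fun j => ?_, h0, fun j hj => ?_, ?_⟩⟩
  · rcases le_or_gt 0 j with h | h
    · obtain ⟨k, rfl⟩ := Int.eq_ofNat_of_zero_le h
      have e := Q.complex.extendXIso embeddingNatInt (i := k) (i' := (k : ℤ)) rfl
      have : Projective (Q.complex.X k) := Q.projective k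
      have : Module.Projective A (Q.complex.X k) :=
        (IsProjective.iff_projective _).2 (by simpa using this)
      exact Module.Projective.of_equiv e.symm.toLinearEquiv
    · have : Subsingleton ((Q.complex.extend embeddingNatInt).X j) :=
        ModuleCat.subsingleton_of_isZero (h0 j h)
      infer_instance
  · rcases le_or_gt 0 j with h | h
    · obtain ⟨k, rfl⟩ := Int.eq_ofNat_of_zero_le h
      obtain ⟨l, rfl⟩ := Nat.exists_eq_succ_of_ne_zero (n := k) (by rintro rfl; simp at hj)
      exact (Q.complex.extend_exactAt_iff embeddingNatInt (j := l + 1) rfl).2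
        (Q.complex_exactAt_succ l)
    · exact ShortComplex.exact_of_isZero_X₂ _ (h0 j h)
  · exact ⟨Q.complex.extendHomologyIso embeddingNatInt (j := 0) rfl ≪≫
      isoOfQuasiIsoAt Q.π 0 ≪≫ HomologicalComplex.singleObjHomologySelfIso _ _ _⟩

end Existence

section Lift

variable {A : Type u} [Ring A]

/-- The part of a complex in nonnegative degrees. -/
def natPart (X : ChainComplex (ModuleCat.{u} A) ℤ) : ChainComplex (ModuleCat.{u} A) ℕ where
  X k := X.X k
  d i j := X.d i j
  shape i j h := X.shape _ _ (by simp only [ComplexShape.down_Rel] at h ⊢; omega)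
  d_comp_d' _ _ _ _ _ := X.d_comp_d _ _ _

/-- A map out of a complex in nonnegative degrees is determined in nonnegative degrees. -/
def homOfNatPart {X Y : ChainComplex (ModuleCat.{u} A) ℤ} (hY : ConcentratedInNonnegDegrees Y)
    (f : natPart X ⟶ natPart Y) : X ⟶ Y where
  f j := match j with
    | Int.ofNat k => f.f k
    | Int.negSucc _ => 0
  comm' i j hij := by
    rcases lt_or_ge j 0 with hj | hj
    · exact (hY j hj).eq_of_tgt _ _
    · obtain ⟨k, rfl⟩ := Int.eq_ofNat_of_zero_le hj
      obtain rfl : i = ((k + 1 : ℕ) : ℤ) := by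
        simp only [ComplexShape.down_Rel] at hij
        omega
      exact f.comm (k + 1) k

theorem exists_comp_eq_of_projective {P : ModuleCat.{u} A} (hP : Module.Projective A P)
    {X Y Z : ModuleCat.{u} A} (a : P ⟶ Y) (f : X ⟶ Y) (g : Y ⟶ Z)
    (hfg : Function.Exact f.hom g.hom) (h : a ≫ g = 0) : ∃ b : P ⟶ X, b ≫ f = a := by
  have ha : ∀ x, a.hom x ∈ LinearMap.range f.hom := fun x => by
    rw [LinearMap.mem_range]
    exact (hfg _).1 (by simpa using congrArg (fun k => k.hom x) h)
  obtain ⟨b, hb⟩ := Module.projective_lifting_property f.hom.rangeRestrict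
    (a.hom.codRestrict _ ha) (LinearMap.surjective_rangeRestrict _)
  refine ⟨ModuleCat.ofHom b, ModuleCat.hom_ext (LinearMap.ext fun x => ?_)⟩
  exact congrArg Subtype.val (LinearMap.congr_fun hb x)

/-- A linear map between augmented modules lifts to a chain map. -/
theorem exists_lift {P Q : ChainComplex (ModuleCat.{u} A) ℤ} {M N : Type u} [AddCommGroup M]
    [AddCommGroup N] [Module A M] [Module A N] {εP : P.X 0 →ₗ[A] M} {εQ : Q.X 0 →ₗ[A] N}
    (hproj : ∀ j, Module.Projective A (P.X j)) (hQ : ConcentratedInNonnegDegrees Q)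
    (hεP : IsAugmentation P εP) (hεQ : IsAugmentation Q εQ) (i : M →ₗ[A] N) :
    ∃ f : P ⟶ Q, ∀ x, εQ ((f.f 0).hom x) = i (εP x) := by
  have := hproj 0
  obtain ⟨f0, hf0⟩ := Module.projective_lifting_property εQ (i ∘ₗ εP) hεQ.surjective
  obtain ⟨f1, hf1⟩ := exists_comp_eq_of_projective (hproj 1) (P.d 1 0 ≫ ModuleCat.ofHom f0)
    (Q.d 1 0) (ModuleCat.ofHom εQ) hεQ.exact_zero (by
      ext x
      change εQ (f0 ((P.d 1 0).hom x)) = 0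
      have := LinearMap.congr_fun hf0 ((P.d 1 0).hom x)
      simp only [LinearMap.comp_apply] at this
      rw [this, hεP.exact_zero.apply_apply_eq_zero, map_zero])
  -- The comparison argument in the form of the recursion `ChainComplex.mkHom`: `f'` followed by two
  -- differentials vanishes, so it lifts through the exact complex `Q`.
  have hsucc : ∀ (n : ℕ) (p : Σ' (f : (natPart P).X n ⟶ (natPart Q).X n)
      (f' : (natPart P).X (n + 1) ⟶ (natPart Q).X (n + 1)),
        f' ≫ (natPart Q).d (n + 1) n = (natPart P).d (n + 1) n ≫ f),
      ∃ f'' : (natPart P).X (n + 2) ⟶ (natPart Q).X (n + 2),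
        f'' ≫ (natPart Q).d (n + 2) (n + 1) = (natPart P).d (n + 2) (n + 1) ≫ p.2.1 := by
    rintro n ⟨f, f', hf⟩
    obtain ⟨f'', h''⟩ := exists_comp_eq_of_projective (hproj ((n + 2 : ℕ) : ℤ))
      (P.d ((n + 2 : ℕ) : ℤ) ((n + 1 : ℕ) : ℤ) ≫ f') (Q.d ((n + 2 : ℕ) : ℤ) ((n + 1 : ℕ) : ℤ))
      (Q.d ((n + 1 : ℕ) : ℤ) n)
      (hεQ.exact _ _ _ (by push_cast; ring) (by push_cast; ring) (by positivity))
      (by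
        refine (Category.assoc _ _ _).trans ((congrArg _ hf).trans ?_)
        exact ((Category.assoc _ _ _).symm.trans
          (congrArg (· ≫ f) (P.d_comp_d _ _ _))).trans Limits.zero_comp)
    exact ⟨f'', h''⟩
  let F : natPart P ⟶ natPart Q := ChainComplex.mkHom _ _ (ModuleCat.ofHom f0) f1
    hf1
    (fun n p => ⟨(hsucc n p).choose, (hsucc n p).choose_spec⟩)
  exact ⟨homOfNatPart hQ F, fun x => LinearMap.congr_fun hf0 x⟩

end Lift

/-! ### Mapping cones and the resolution of a cokernel -/

section Cone

variable {A : Type u} [Ring A] {X Y : ChainComplex (ModuleCat.{u} A) ℤ} (f : X ⟶ Y)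

open HomologicalComplex.homotopyCofiber in
/-- The chain modules of a mapping cone are products. -/
def mappingConeEquiv (i j : ℤ) (hij : j + 1 = i) :
    (mappingCone f).X i ≃ₗ[A] X.X j × Y.X i :=
  (XIsoBiprod f i j hij ≪≫ ModuleCat.biprodIsoProd _ _).toLinearEquiv

open HomologicalComplex.homotopyCofiber in
theorem mappingConeEquiv_fst (i j : ℤ) (hij : j + 1 = i) (z : (mappingCone f).X i) :
    (mappingConeEquiv f i j hij z).1 = (fstX f i j hij).hom z := by
  have h : (ModuleCat.biprodIsoProd (X.X j) (Y.X i)).hom ≫ ModuleCat.ofHom (LinearMap.fst A _ _) =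
      Limits.biprod.fst := by
    rw [← Iso.eq_inv_comp, ModuleCat.biprodIsoProd_inv_comp_fst]
  exact congrArg (fun k => k.hom ((XIsoBiprod f i j hij).hom.hom z)) h

open HomologicalComplex.homotopyCofiber in
theorem mappingConeEquiv_snd (i j : ℤ) (hij : j + 1 = i) (z : (mappingCone f).X i) :
    (mappingConeEquiv f i j hij z).2 = (sndX f i).hom z := by
  have h : (ModuleCat.biprodIsoProd (X.X j) (Y.X i)).hom ≫ ModuleCat.ofHom (LinearMap.snd A _ _) =
      Limits.biprod.snd := by
    rw [← Iso.eq_inv_comp, ModuleCat.biprodIsoProd_inv_comp_snd]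
  have h' : sndX f i = (XIsoBiprod f i j hij).hom ≫ Limits.biprod.snd := by
    have : (ComplexShape.down ℤ).next i = j := (ComplexShape.down ℤ).next_eq' hij
    subst this
    rw [sndX, dif_pos (by exact hij)]
  rw [h']
  exact congrArg (fun k => k.hom ((XIsoBiprod f i j hij).hom.hom z)) h

/-- All computations in cones go through this formula; its signs are those of the stated convention
for `Cone(f)`. -/
theorem mappingConeEquiv_d (i j k : ℤ) (hij : j + 1 = i) (hjk : k + 1 = j)
    (z : (mappingCone f).X i) :
    mappingConeEquiv f j k hjk (((mappingCone f).d i j).hom z) =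
      (-(X.d j k).hom (mappingConeEquiv f i j hij z).1,
        (f.f j).hom (mappingConeEquiv f i j hij z).1 +
          (Y.d i j).hom (mappingConeEquiv f i j hij z).2) := by
  refine Prod.ext ?_ ?_
  · rw [mappingConeEquiv_fst, mappingConeEquiv_fst]
    exact congrArg (fun k => k.hom z) (HomologicalComplex.homotopyCofiber.d_fstX f i j k hij hjk)
  · rw [mappingConeEquiv_snd, mappingConeEquiv_snd, mappingConeEquiv_fst]
    exact congrArg (fun k => k.hom z) (HomologicalComplex.homotopyCofiber.d_sndX f i j hij)

end Cone

section ConeResolution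

variable {A : Type u} [Ring A]

theorem isZero_of_forall_eq_zero {M : ModuleCat.{u} A} (h : ∀ x : M, x = 0) : Limits.IsZero M := by
  have : Subsingleton M := ⟨fun x y => by rw [h x, h y]⟩
  exact ModuleCat.isZero_of_subsingleton M

/-- The mapping cone of a lift of an injective map to projective resolutions resolves the
cokernel. -/
theorem exists_mappingCone_isProjectiveResolution {K L M : ModuleCat.{u} A}
    {P Q : ChainComplex (ModuleCat.{u} A) ℤ} (hP : IsProjectiveResolution P K)
    (hQ : IsProjectiveResolution Q L) (i : K →ₗ[A] L) (p : L →ₗ[A] M)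
    (hi : Function.Injective i) (hip : Function.Exact i p) (hp : Function.Surjective p) :
    ∃ f : P ⟶ Q, IsProjectiveResolution (mappingCone f) M := by
  obtain ⟨εP, hεP⟩ := hP.exists_isAugmentation
  obtain ⟨εQ, hεQ⟩ := hQ.exists_isAugmentation
  obtain ⟨f, hf⟩ := exists_lift hP.projective hQ.nonneg hεP hεQ i
  let e0 := mappingConeEquiv f 0 (-1) (by simp)
  -- In degree 0 the summand coming from `P` is `P.X (-1) = 0`, so only the component in `Q`
  -- matters.
  let ε : (mappingCone f).X 0 →ₗ[A] M := p ∘ₗ εQ ∘ₗ LinearMap.snd A _ _ ∘ₗ e0.toLinearMap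
  have hε : ∀ z, ε z = p (εQ (e0 z).2) := fun _ => rfl
  refine ⟨f, isProjectiveResolution_of_isAugmentation (ε := ε) (fun j _ => ?_) (fun j hj => ?_)
    ⟨?_, ?_, ?_⟩⟩
  · have := hP.projective (j - 1)
    have := hQ.projective j
    exact Module.Projective.of_equiv (mappingConeEquiv f j (j - 1) (by ring)).symm
  · refine isZero_of_forall_eq_zero fun z => (mappingConeEquiv f j (j - 1) (by ring)).injective ?_
    rw [map_zero]
    exact Prod.ext (hP.nonneg.apply_eq_zero (by omega) _) (hQ.nonneg.apply_eq_zero hj _)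
  · exact hp.comp (hεQ.surjective.comp (Prod.snd_surjective.comp e0.surjective))
  · intro z
    rw [hε]
    have h1 : (e0 z).1 = 0 := hP.nonneg.apply_eq_zero (by simp) _
    constructor
    · intro hz
      obtain ⟨a, ha⟩ := (hip _).1 hz
      obtain ⟨x, rfl⟩ := hεP.surjective a
      have : εQ ((e0 z).2 - (f.f 0).hom x) = 0 := by rw [map_sub, hf, ha, sub_self]
      obtain ⟨y, hy⟩ := (hεQ.exact_zero _).1 this
      refine ⟨(mappingConeEquiv f 1 0 (by simp)).symm (x, y), e0.injective ?_⟩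
      rw [mappingConeEquiv_d f 1 0 (-1) (by simp) (by simp)]
      refine Prod.ext ((hP.nonneg.apply_eq_zero (by simp) _).trans h1.symm) ?_
      simp [hy]
    · rintro ⟨w, rfl⟩
      rw [mappingConeEquiv_d f 1 0 (-1) (by simp) (by simp)]
      simp [hf, hip.apply_apply_eq_zero, hεQ.exact_zero.apply_apply_eq_zero]
  · intro a b c hab hbc hb z
    constructor
    · intro hz
      have hz' := mappingConeEquiv_d f b c (c - 1) hbc (by ring) z
      rw [hz, map_zero, eq_comm, Prod.mk_eq_zero] at hz'
      obtain ⟨h1, h2⟩ := hz'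
      obtain ⟨x', hx'⟩ : ∃ x', (P.d b c).hom x' = -(mappingConeEquiv f b c hbc z).1 := by
        -- For `c > 0` the complex `P` is exact at `c`. For `c = 0` one needs `εP z₁ = 0`: applying
        -- `εQ` to `f z₁ + ∂z₂ = 0` gives `i (εP z₁) = 0`, and `i` is injective.
        rcases (show 0 ≤ c by omega).lt_or_eq with hc | hc
        · exact (hεP.exact b c (c - 1) hbc (by ring) hc _).1 (by rw [map_neg, h1])
        · subst hc
          obtain rfl : b = 1 := by omega
          refine (hεP.exact_zero _).1 (hi ?_)
          have h3 := congrArg εQ h2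
          rw [map_add, hf, hεQ.exact_zero.apply_apply_eq_zero, add_zero, map_zero] at h3
          rw [map_neg, map_neg, h3, map_zero, neg_zero]
      have hcomm : (Q.d b c).hom ((f.f b).hom x') = (f.f c).hom ((P.d b c).hom x') :=
        congrArg (fun k => k.hom x') (f.comm b c)
      obtain ⟨y', hy'⟩ := (hεQ.exact a b c hab hbc hb
        ((mappingConeEquiv f b c hbc z).2 - (f.f b).hom x')).1 (by
          rw [map_sub, hcomm, hx', map_neg, sub_neg_eq_add, add_comm, h2])
      refine ⟨(mappingConeEquiv f a b hab).symm (x', y'),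
        (mappingConeEquiv f b c hbc).injective ?_⟩
      rw [mappingConeEquiv_d f a b c hab hbc, LinearEquiv.apply_symm_apply]
      refine Prod.ext ?_ ?_
      · simp [hx']
      · simp [hy']
    · rintro ⟨w, rfl⟩
      exact congrArg (fun k => k.hom w) ((mappingCone f).d_comp_d a b c)

end ConeResolution

/-! ### Products of resolutions -/

theorem Function.Exact.prodMap_prodMap {α β γ α' β' γ' : Type*} [Zero γ] [Zero γ'] {f : α → β}
    {g : β → γ} {f' : α' → β'} {g' : β' → γ'} (h : Function.Exact f g)
    (h' : Function.Exact f' g') : Function.Exact (Prod.map f f') (Prod.map g g') := by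
  intro z
  rw [Set.range_prodMap, Set.mem_prod, ← h, ← h']
  exact Prod.mk_eq_zero

section ProdComplex

variable {A : Type u} [Ring A]

/-- The degreewise product of two complexes. -/
def prodComplex (X Y : ChainComplex (ModuleCat.{u} A) ℤ) : ChainComplex (ModuleCat.{u} A) ℤ where
  X j := ModuleCat.of A (X.X j × Y.X j)
  d i j := ModuleCat.ofHom ((X.d i j).hom.prodMap (Y.d i j).hom)
  shape i j h := by
    rw [X.shape i j h, Y.shape i j h]
    rfl
  d_comp_d' i j k _ _ := by
    refine ModuleCat.hom_ext (LinearMap.ext fun (z : X.X i × Y.X i) => ?_)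
    exact Prod.ext (congrArg (fun f => f.hom z.1) (X.d_comp_d i j k))
      (congrArg (fun f => f.hom z.2) (Y.d_comp_d i j k))

/-- The cone of the zero map `X → ΣY` is `Σ(X × Y)`. -/
def mappingConeZeroIso (X Y : ChainComplex (ModuleCat.{u} A) ℤ) :
    mappingCone (0 : X ⟶ suspension Y) ≅ suspension (prodComplex X Y) :=
  HomologicalComplex.Hom.isoOfComponents
    (fun i => (mappingConeEquiv (0 : X ⟶ suspension Y) i (i - 1) (by ring)).toModuleIso)
    fun i j hij => by
      obtain rfl : j = i - 1 := by
        simp only [ComplexShape.down_Rel] at hij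
        omega
      refine ModuleCat.hom_ext (LinearMap.ext fun z => ?_)
      have h := mappingConeEquiv_d (0 : X ⟶ suspension Y) i (i - 1) (i - 1 - 1) hij (by ring) z
      refine Eq.trans ?_ h.symm
      refine Prod.ext rfl ?_
      exact (zero_add _).symm

theorem IsProjectiveResolution.prod {X Y : ChainComplex (ModuleCat.{u} A) ℤ}
    {M N : ModuleCat.{u} A} (hX : IsProjectiveResolution X M) (hY : IsProjectiveResolution Y N) :
    IsProjectiveResolution (prodComplex X Y) (ModuleCat.of A (M × N)) := by
  obtain ⟨ε, hε⟩ := hX.exists_isAugmentation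
  obtain ⟨η, hη⟩ := hY.exists_isAugmentation
  refine isProjectiveResolution_of_isAugmentation (ε := ε.prodMap η) (fun j _ => ?_)
    (fun j hj => isZero_of_forall_eq_zero fun z =>
      Prod.ext (hX.nonneg.apply_eq_zero hj _) (hY.nonneg.apply_eq_zero hj _)) ⟨?_, ?_, ?_⟩
  · have := hX.projective j
    have := hY.projective j
    exact inferInstanceAs (Module.Projective A (X.X j × Y.X j))
  · exact hε.surjective.prodMap hη.surjective
  · exact hε.exact_zero.prodMap_prodMap hη.exact_zero
  · intro i j k hij hjk hj
    exact (hε.exact i j k hij hjk hj).prodMap_prodMap (hη.exact i j k hij hjk hj)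

theorem IsProjectiveResolution.of_linearEquiv {X : ChainComplex (ModuleCat.{u} A) ℤ}
    {M N : ModuleCat.{u} A} (hX : IsProjectiveResolution X M) (e : M ≃ₗ[A] N) :
    IsProjectiveResolution X N :=
  ⟨hX.projective, hX.nonneg, hX.exact, hX.homology_zero.map fun i => i ≪≫ e.toModuleIso⟩

end ProdComplex

/-! ### Modules with a resolution in a bootstrappable property -/

section HasResolutionIn

variable {A : Type u} [Ring A]

/-- The module `M` has a projective resolution lying in `B n`. -/
def HasResolutionIn (B : ℤ → ChainComplex (ModuleCat.{u} A) ℤ → Prop) (n : ℤ) (M : Type u)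
    [AddCommGroup M] [Module A M] : Prop :=
  ∃ P : ChainComplex (ModuleCat.{u} A) ℤ, IsProjectiveResolution P (ModuleCat.of A M) ∧ B n P

variable {B : ℤ → ChainComplex (ModuleCat.{u} A) ℤ → Prop} {n : ℤ}
  {K L M : Type u} [AddCommGroup K] [Module A K] [AddCommGroup L] [Module A L] [AddCommGroup M]
  [Module A M]

theorem HasResolutionIn.of_linearEquiv (h : HasResolutionIn B n M) (e : M ≃ₗ[A] L) :
    HasResolutionIn B n L := by
  obtain ⟨P, hP, hB⟩ := h
  exact ⟨P, hP.of_linearEquiv e, hB⟩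

theorem IsBootstrappable.hasResolutionIn_of_neg (hB : IsBootstrappable B) (hn : n < 0)
    (M : Type u) [AddCommGroup M] [Module A M] : HasResolutionIn B n M := by
  obtain ⟨P, hP⟩ := exists_isProjectiveResolution (ModuleCat.of A M)
  exact ⟨P, hP, hB.degree P hP.nonneg n hn⟩

/-- The dimension-shifting principle behind every later result: the cone of a lift of `i` resolves
`M`. -/
theorem IsBootstrappable.hasResolutionIn_of_exact (hB : IsBootstrappable B) {i : K →ₗ[A] L}
    {p : L →ₗ[A] M} (hi : Function.Injective i) (hip : Function.Exact i p)
    (hp : Function.Surjective p) (hK : HasResolutionIn B (n - 1) K) (hL : HasResolutionIn B n L) :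
    HasResolutionIn B n M := by
  rcases lt_or_ge n 0 with hn | hn
  · exact hB.hasResolutionIn_of_neg hn M
  obtain ⟨k, rfl⟩ := Int.eq_ofNat_of_zero_le hn
  obtain ⟨P, hP, hBP⟩ := hK
  obtain ⟨Q, hQ, hBQ⟩ := hL
  obtain ⟨f, hf⟩ := exists_mappingCone_isProjectiveResolution (M := ModuleCat.of A M) hP hQ i p
    hi hip hp
  exact ⟨_, hf, hB.cone k P Q f hBP hBQ⟩

/-- Sums are not among the axioms. For `n ≥ 0`, `ΣY` lies in degree `n + 1`, hence so does the cone
of `0 : X → ΣY`, which is `Σ(X × Y)`; the suspension axiom read backwards removes `Σ`. -/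
theorem IsBootstrappable.hasResolutionIn_prod (hB : IsBootstrappable B)
    (hM : HasResolutionIn B n M) (hL : HasResolutionIn B n L) : HasResolutionIn B n (M × L) := by
  rcases lt_or_ge n 0 with hn | hn
  · exact hB.hasResolutionIn_of_neg hn _
  obtain ⟨k, rfl⟩ := Int.eq_ofNat_of_zero_le hn
  obtain ⟨P, hP, hBP⟩ := hM
  obtain ⟨Q, hQ, hBQ⟩ := hL
  refine ⟨_, hP.prod hQ, (hB.suspension_iff k _).2 (hB.of_iso _ _ _ ⟨mappingConeZeroIso P Q⟩ ?_)⟩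
  have := hB.cone (k + 1) P (suspension Q) 0 (by simpa using hBP)
    (by simpa using (hB.suspension_iff k Q).1 hBQ)
  simpa using this

/-- The sum must be non-empty: the axioms allow `B n` to be empty for all `n ≥ 0`, so nothing is
known about the zero module. -/
theorem IsBootstrappable.hasResolutionIn_pi (hB : IsBootstrappable B) (k : ℕ)
    (M : Fin (k + 1) → Type u) [∀ i, AddCommGroup (M i)] [∀ i, Module A (M i)]
    (h : ∀ i, HasResolutionIn B n (M i)) : HasResolutionIn B n (∀ i, M i) := by
  induction k with
  | zero => exact (h 0).of_linearEquiv (LinearEquiv.piUnique (α := Fin 1) A M).symm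
  | succ k ih =>
    exact (hB.hasResolutionIn_prod (h 0) (ih (fun i => M i.succ) fun i => h _)).of_linearEquiv
      (Fin.consLinearEquiv A M)

end HasResolutionIn

/-! ### Extension of scalars -/

section InducedModule

open TensorProduct

variable {S A : Type u} [Ring S] [Ring A] (f : S →+* A)
  {M N L : Type u} [AddCommGroup M] [Module S M] [AddCommGroup N] [Module S N] [AddCommGroup L]

/-- The element `a ⊗ m` of `A ⊗_S M`. -/
def inducedMk (a : A) (m : M) : InducedModule f M := Submodule.Quotient.mk (a ⊗ₜ[ℤ] m)

theorem inducedMk_add (a : A) (m m' : M) :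
    inducedMk f a (m + m') = inducedMk f a m + inducedMk f a m' := by
  simp only [inducedMk, TensorProduct.tmul_add, Submodule.Quotient.mk_add]

theorem inducedMk_zero (a : A) : inducedMk f a (0 : M) = 0 := by
  simp only [inducedMk, TensorProduct.tmul_zero, Submodule.Quotient.mk_zero]

theorem add_inducedMk (a a' : A) (m : M) :
    inducedMk f (a + a') m = inducedMk f a m + inducedMk f a' m := by
  simp only [inducedMk, TensorProduct.add_tmul, Submodule.Quotient.mk_add]

theorem smul_inducedMk (a b : A) (m : M) : a • inducedMk f b m = inducedMk f (a * b) m := rfl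

theorem inducedMk_smul (a : A) (s : S) (m : M) :
    inducedMk f a (s • m) = inducedMk f (a * f s) m := by
  refine ((Submodule.Quotient.eq _).2 ?_).symm
  exact Submodule.subset_span ⟨a, s, m, rfl⟩

theorem inducedMap_inducedMk (g : M →ₗ[S] N) (a : A) (m : M) :
    inducedMap f g (inducedMk f a m) = inducedMk f a (g m) := rfl

theorem inducedModule_induction {p : InducedModule f M → Prop} (h0 : p 0)
    (hadd : ∀ x y, p x → p y → p (x + y)) (hmk : ∀ a m, p (inducedMk f a m)) (x) : p x := by
  obtain ⟨x, rfl⟩ := Submodule.Quotient.mk_surjective _ x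
  induction x using TensorProduct.induction_on with
  | zero => exact h0
  | tmul a m => exact hmk a m
  | add x y hx hy => exact hadd _ _ hx hy

/-- The linear map `A ⊗_S M → L` attached to a semilinear map `M → L`. -/
def inducedLift [Module A L] (g : M →ₛₗ[f] L) : InducedModule f M →ₗ[A] L :=
  Submodule.liftQ _ (TensorProduct.AlgebraTensorModule.lift
    (LinearMap.toSpanSingleton A (M →ₗ[ℤ] L) g.toAddMonoidHom.toIntLinearMap)) (by
      refine Submodule.span_le.2 ?_
      rintro _ ⟨a, s, m, rfl⟩
      simp [mul_smul])

theorem inducedLift_inducedMk [Module A L] (g : M →ₛₗ[f] L) (a : A) (m : M) :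
    inducedLift f g (inducedMk f a m) = a • g m := rfl

/-- A surjection `p` onto `A ⊗_S M` is split by adjunction: over `S` the map `m ↦ 1 ⊗ m` lifts
through `p` since `M` is projective, and the lift extends `A`-linearly. -/
instance inducedModule_projective [hM : Module.Projective S M] :
    Module.Projective A (InducedModule f M) := by
  refine Module.Projective.of_lifting_property'' fun p hp => ?_
  let : Module S (InducedModule f M →₀ A) := Module.compHom _ f
  let : Module S (InducedModule f M) := Module.compHom _ f
  let p' : (InducedModule f M →₀ A) →ₗ[S] InducedModule f M :=
    { p with map_smul' := fun s x => p.map_smul (f s) x }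
  let j : M →ₗ[S] InducedModule f M :=
    { toFun := inducedMk f 1
      map_add' := inducedMk_add f 1
      map_smul' := fun s m => by
        rw [inducedMk_smul, one_mul]
        exact (congrArg (inducedMk f · m) (mul_one (f s))).symm }
  obtain ⟨k, hk⟩ := Module.projective_lifting_property p' j hp
  let k' : M →ₛₗ[f] (InducedModule f M →₀ A) :=
    { k with map_smul' := fun s x => k.map_smul s x }
  refine ⟨inducedLift f k', inducedModule_hom_ext f fun a m => ?_⟩
  change p (inducedLift f k' (inducedMk f a m)) = inducedMk f a m
  rw [inducedLift_inducedMk, map_smul]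
  have : p (k' m) = inducedMk f 1 m := LinearMap.congr_fun hk m
  rw [this, smul_inducedMk, mul_one]

theorem inducedModule_finite [hM : Module.Finite S M] : Module.Finite A (InducedModule f M) := by
  classical
  obtain ⟨T, hT⟩ := hM.fg_top
  refine ⟨⟨T.image (inducedMk f 1), top_unique fun x _ => ?_⟩⟩
  set W := Submodule.span A (T.image (inducedMk f 1) : Set (InducedModule f M)) with hW
  have key : ∀ m : M, inducedMk f 1 m ∈ W := by
    intro m
    have hm : m ∈ Submodule.span S (T : Set M) := hT ▸ Submodule.mem_top
    induction hm using Submodule.span_induction with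
    | mem m hm =>
      exact Submodule.subset_span (Finset.mem_coe.2 (Finset.mem_image_of_mem _ (Finset.mem_coe.1 hm)))
    | zero => rw [inducedMk_zero]; exact W.zero_mem
    | add m m' _ _ h h' => rw [inducedMk_add]; exact W.add_mem h h'
    | smul s m _ h =>
      rw [inducedMk_smul, one_mul, ← mul_one (f s), ← smul_inducedMk]
      exact W.smul_mem _ h
  refine inducedModule_induction f (p := (· ∈ W)) W.zero_mem (fun _ _ => W.add_mem)
    (fun a m => ?_) x
  rw [← mul_one a, ← smul_inducedMk]
  exact W.smul_mem _ (key m)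

theorem inducedMap_surjective {g : M →ₗ[S] N} (hg : Function.Surjective g) :
    Function.Surjective (inducedMap f g) := fun y => by
  refine inducedModule_induction f (p := fun y => ∃ x, inducedMap f g x = y) ⟨0, map_zero _⟩
    ?_ ?_ y
  · rintro _ _ ⟨x, rfl⟩ ⟨y, rfl⟩
    exact ⟨x + y, map_add _ _ _⟩
  · intro a n
    obtain ⟨m, rfl⟩ := hg n
    exact ⟨inducedMk f a m, rfl⟩

end InducedModule

/-! ### Induction from a subgroup is exact -/

section GroupRing

open TensorProduct

variable (R : Type u) [Ring R] {Γ : Type u} [Group Γ] (Δ : Subgroup Γ)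

/-- The inclusion of group rings `RΔ → RΓ`. -/
abbrev subgroupRingHom : MonoidAlgebra R Δ →+* MonoidAlgebra R Γ :=
  MonoidAlgebra.mapDomainRingHom R Δ.subtype

variable {Δ} in
/-- The element `h ∈ Δ` such that `γ = s(γΔ) h` for the chosen section `s`. -/
def cosetFactor (γ : Γ) : Δ :=
  ⟨(γ : Γ ⧸ Δ).out⁻¹ * γ, QuotientGroup.eq.1 (QuotientGroup.out_eq' _)⟩

theorem cosetFactor_mul (γ : Γ) (h : Δ) :
    cosetFactor (γ * (h : Γ)) = (cosetFactor γ : Δ) * h := by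
  have : ((γ * (h : Γ) : Γ) : Γ ⧸ Δ) = γ := by simp
  refine Subtype.ext ?_
  simp only [cosetFactor, this, Subgroup.coe_mul, mul_assoc]

theorem cosetFactor_out (q : Γ ⧸ Δ) : (cosetFactor q.out : Δ) = 1 := by
  refine Subtype.ext ?_
  simp [cosetFactor]

theorem out_mul_cosetFactor (γ : Γ) :
    (γ : Γ ⧸ Δ).out * ((cosetFactor γ : Δ) : Γ) = γ := by
  simp [cosetFactor]

section

variable (M : Type u) [AddCommGroup M] [Module (MonoidAlgebra R Δ) M]

/-- The map `⨁_{Γ/Δ} M → RΓ ⊗_ℤ M` given by the chosen representatives of the cosets. -/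
def cosetSumToTensor : ((Γ ⧸ Δ) →₀ M) →+ MonoidAlgebra R Γ ⊗[ℤ] M :=
  Finsupp.liftAddHom fun q =>
    (TensorProduct.mk ℤ (MonoidAlgebra R Γ) M (MonoidAlgebra.single q.out 1)).toAddMonoidHom

/-- The map `⨁_{Γ/Δ} M → RΓ ⊗_{RΔ} M` given by the chosen representatives of the cosets. -/
def cosetSumToInduced : ((Γ ⧸ Δ) →₀ M) →+ InducedModule (subgroupRingHom R Δ) M :=
  (balancedRelations (subgroupRingHom R Δ) M).mkQ.toAddMonoidHom.comp (cosetSumToTensor R Δ M)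

theorem cosetSumToInduced_single (q : Γ ⧸ Δ) (m : M) :
    cosetSumToInduced R Δ M (Finsupp.single q m) =
      inducedMk (subgroupRingHom R Δ) (MonoidAlgebra.single q.out 1) m := by
  simp [cosetSumToInduced, cosetSumToTensor, inducedMk]

/-- The map `RΓ ⊗_ℤ M → ⨁_{Γ/Δ} M` sending `rγ ⊗ m` to `r h m` in the summand `γΔ`, where `h` is
the factor of `γ` in `Δ`. -/
def tensorToCosetSum : MonoidAlgebra R Γ ⊗[ℤ] M →+ ((Γ ⧸ Δ) →₀ M) :=
  TensorProduct.liftAddHom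
    ((Finsupp.liftAddHom fun γ : Γ =>
      { toFun := fun r => (Finsupp.singleAddHom (γ : Γ ⧸ Δ)).comp
          (DistribSMul.toAddMonoidHom M (MonoidAlgebra.single (cosetFactor γ : Δ) r))
        map_zero' := by ext; simp
        map_add' := fun r r' => by ext m; simp [add_smul] }).comp
      MonoidAlgebra.coeffAddEquiv.toAddMonoidHom)
    fun r a m => by rw [map_zsmul, map_zsmul, AddMonoidHom.coe_smul, Pi.smul_apply]

theorem tensorToCosetSum_single_tmul (γ : Γ) (r : R) (m : M) :
    tensorToCosetSum R Δ M (MonoidAlgebra.single γ r ⊗ₜ[ℤ] m) =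
      Finsupp.single (γ : Γ ⧸ Δ) (MonoidAlgebra.single (cosetFactor γ : Δ) r • m) := by
  simp [tensorToCosetSum]

/-- Replacing `γ` by `γh` leaves the coset, hence the chosen representative, unchanged and
multiplies the factor in `Δ` by `h` on the right. -/
theorem tensorToCosetSum_balanced (a : MonoidAlgebra R Γ) (s : MonoidAlgebra R Δ) (m : M) :
    tensorToCosetSum R Δ M ((a * subgroupRingHom R Δ s) ⊗ₜ[ℤ] m) =
      tensorToCosetSum R Δ M (a ⊗ₜ[ℤ] (s • m)) := by
  induction a using MonoidAlgebra.induction_linear with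
  | zero => simp
  | add a b ha hb => rw [add_mul, add_tmul, add_tmul, map_add, map_add, ha, hb]
  | single γ r =>
    induction s using MonoidAlgebra.induction_linear with
    | zero => simp
    | add s t hs ht => rw [map_add, mul_add, add_tmul, add_smul, tmul_add, map_add, map_add, hs, ht]
    | single h r' =>
      have h1 : ((γ * (h : Γ) : Γ) : Γ ⧸ Δ) = γ := by simp
      have h2 : subgroupRingHom R Δ (MonoidAlgebra.single h r') =
        MonoidAlgebra.single (h : Γ) r' := by simp
      rw [h2, MonoidAlgebra.single_mul_single, tensorToCosetSum_single_tmul,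
        tensorToCosetSum_single_tmul, h1, cosetFactor_mul, ← mul_smul,
        MonoidAlgebra.single_mul_single]

theorem tensorToCosetSum_eq_zero {x : MonoidAlgebra R Γ ⊗[ℤ] M}
    (hx : x ∈ balancedRelations (subgroupRingHom R Δ) M) : tensorToCosetSum R Δ M x = 0 := by
  -- The relations are spanned over `RΓ` while the map is only additive, so the induction must carry
  -- all multiples of `x`.
  suffices ∀ b : MonoidAlgebra R Γ, tensorToCosetSum R Δ M (b • x) = 0 by simpa using this 1
  induction hx using Submodule.span_induction with
  | mem x hx =>
    obtain ⟨a, s, m, rfl⟩ := hx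
    intro b
    rw [smul_sub, TensorProduct.smul_tmul', TensorProduct.smul_tmul', map_sub, smul_eq_mul,
      smul_eq_mul, ← mul_assoc, tensorToCosetSum_balanced, sub_self]
  | zero => simp
  | add x y _ _ hx hy => intro b; rw [smul_add, map_add, hx, hy, add_zero]
  | smul a x _ hx => intro b; rw [← mul_smul, hx]

/-- `tensorToCosetSum` kills the relations and is a left inverse on representatives. With
surjectivity this says that `RΓ` is free over `RΔ` on coset representatives. -/
theorem cosetSumToInduced_injective : Function.Injective (cosetSumToInduced R Δ M) := by
  have hinv : (tensorToCosetSum R Δ M).comp (cosetSumToTensor R Δ M) = AddMonoidHom.id _ := by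
    refine Finsupp.addHom_ext fun q m => ?_
    simp only [cosetSumToTensor, AddMonoidHom.comp_apply, Finsupp.liftAddHom_apply_single,
      LinearMap.toAddMonoidHom_coe, TensorProduct.mk_apply, tensorToCosetSum_single_tmul,
      cosetFactor_out, AddMonoidHom.id_apply]
    rw [← MonoidAlgebra.one_def, one_smul]
    simp
  refine (injective_iff_map_eq_zero _).2 fun x hx => ?_
  have h1 := tensorToCosetSum_eq_zero R Δ M ((Submodule.Quotient.mk_eq_zero _).1 hx)
  exact (DFunLike.congr_fun hinv x).symm.trans h1

theorem cosetSumToInduced_surjective : Function.Surjective (cosetSumToInduced R Δ M) := by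
  intro y
  refine inducedModule_induction _ (p := (· ∈ (cosetSumToInduced R Δ M).range)) (zero_mem _)
    (fun _ _ => add_mem) (fun a m => ?_) y
  induction a using MonoidAlgebra.induction_linear with
  | zero =>
    have : inducedMk (subgroupRingHom R Δ) 0 m = 0 := by simp [inducedMk]
    rw [this]
    exact zero_mem _
  | add a b ha hb => rw [add_inducedMk]; exact add_mem ha hb
  | single γ r =>
    refine ⟨Finsupp.single (γ : Γ ⧸ Δ) (MonoidAlgebra.single (cosetFactor γ : Δ) r • m), ?_⟩
    rw [cosetSumToInduced_single, inducedMk_smul]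
    congr 1
    simp [out_mul_cosetFactor]

variable {M} {N L : Type u} [AddCommGroup N] [Module (MonoidAlgebra R Δ) N] [AddCommGroup L]
  [Module (MonoidAlgebra R Δ) L]

theorem inducedMap_cosetSumToInduced (g : M →ₗ[MonoidAlgebra R Δ] N) (x : (Γ ⧸ Δ) →₀ M) :
    inducedMap (subgroupRingHom R Δ) g (cosetSumToInduced R Δ M x) =
      cosetSumToInduced R Δ N (x.mapRange g (map_zero g)) := by
  induction x using Finsupp.induction_linear with
  | zero => simp
  | add x y hx hy => rw [map_add, map_add, hx, hy, Finsupp.mapRange_add (map_add g), map_add]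
  | single q m =>
    rw [Finsupp.mapRange_single, cosetSumToInduced_single, cosetSumToInduced_single,
      inducedMap_inducedMk]

theorem Finsupp.exact_mapRange {ι M N L : Type*} [Zero M] [Zero N] [Zero L] {g : M → N} {h : N → L}
    (hg : g 0 = 0) (hh : h 0 = 0) (H : Function.Exact g h) :
    Function.Exact (Finsupp.mapRange (α := ι) g hg) (Finsupp.mapRange h hh) := by
  classical
  intro y
  constructor
  · intro hy
    have : ∀ i, ∃ x, g x = y i := fun i => (H _).1 (by simpa using DFunLike.congr_fun hy i)
    choose x hx using this
    -- The preimage is taken to be 0 wherever `y` vanishes, which keeps its support finite.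
    refine ⟨Finsupp.onFinset y.support (fun i => if y i = 0 then 0 else x i) fun i hi => ?_, ?_⟩
    · simp only [ne_eq, ite_eq_left_iff, not_forall] at hi
      exact Finsupp.mem_support_iff.2 hi.1
    · ext i
      by_cases hi : y i = 0 <;> simp [hi, hg, hx]
  · rintro ⟨x, rfl⟩
    ext i
    simpa using H.apply_apply_eq_zero (x i)

/-- The ring `RΓ` is flat as a right `RΔ`-module. -/
theorem inducedMap_exact {g : M →ₗ[MonoidAlgebra R Δ] N} {h : N →ₗ[MonoidAlgebra R Δ] L}
    (H : Function.Exact g h) :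
    Function.Exact (inducedMap (subgroupRingHom R Δ) g) (inducedMap (subgroupRingHom R Δ) h) := by
  intro y
  obtain ⟨y, rfl⟩ := cosetSumToInduced_surjective R Δ N y
  have H' := Finsupp.exact_mapRange (ι := Γ ⧸ Δ) (map_zero g) (map_zero h) H
  rw [inducedMap_cosetSumToInduced, map_eq_zero_iff _ (cosetSumToInduced_injective R Δ L), H']
  constructor
  · rintro ⟨x, rfl⟩
    exact ⟨cosetSumToInduced R Δ M x, inducedMap_cosetSumToInduced R Δ g x⟩
  · rintro ⟨x, hx⟩
    obtain ⟨x, rfl⟩ := cosetSumToInduced_surjective R Δ M x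
    rw [inducedMap_cosetSumToInduced] at hx
    exact ⟨x, cosetSumToInduced_injective R Δ N hx⟩

end

/-- Projectivity survives any extension of scalars; exactness survives because `RΓ` is flat over
`RΔ`. -/
theorem IsProjectiveResolution.groupInduction {P : ChainComplex (ModuleCat.{u} (MonoidAlgebra R Δ)) ℤ}
    {M : ModuleCat.{u} (MonoidAlgebra R Δ)} (h : IsProjectiveResolution P M) :
    IsProjectiveResolution (groupInduction R Δ P)
      (ModuleCat.of (MonoidAlgebra R Γ) (InducedModule (subgroupRingHom R Δ) M)) := by
  obtain ⟨ε, hε⟩ := h.exists_isAugmentation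
  refine isProjectiveResolution_of_isAugmentation
    (ε := inducedMap (subgroupRingHom R Δ) ε) (fun j _ => ?_) (fun j hj => ?_) ⟨?_, ?_, ?_⟩
  · have := h.projective j
    exact inducedModule_projective (subgroupRingHom R Δ) (M := P.X j)
  · exact (inductionFunctor (subgroupRingHom R Δ)).map_isZero (h.nonneg j hj)
  · exact inducedMap_surjective _ hε.surjective
  · exact inducedMap_exact R Δ hε.exact_zero
  · intro i j k hij hjk hj
    exact inducedMap_exact R Δ (hε.exact i j k hij hjk hj)

theorem IsEquivariantlyBootstrappable.hasResolutionIn_induced {C : ISClass.{u}}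
    {E : ∀ (Γ : Type u) [Group Γ], ℤ → ChainComplex (ModuleCat.{u} (MonoidAlgebra R Γ)) ℤ → Prop}
    (hE : IsEquivariantlyBootstrappable R C E) (hΓ : C.Mem Γ) {n : ℤ} {M : Type u} [AddCommGroup M]
    [Module (MonoidAlgebra R Δ) M] (hM : HasResolutionIn (E Δ) n M) :
    HasResolutionIn (E Γ) n (InducedModule (subgroupRingHom R Δ) M) := by
  obtain ⟨P, hP, hB⟩ := hM
  exact ⟨_, hP.groupInduction, hE.induction n Γ hΓ Δ P hB⟩

end GroupRing

/-! ### Modules of type `FP` and their closure properties -/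

section FiniteType

/-- `HasFP A k M` says that `M` is of type `FP_{k-1}`: there is a partial projective resolution
`P_{k-1} → ⋯ → P₀ → M → 0` by `k` finitely generated modules. -/
def HasFP (A : Type u) [Ring A] : ℕ → ∀ (M : Type u) [AddCommGroup M] [Module A M], Prop
  | 0, _, _, _ => True
  | k + 1, M, _, _ => ∃ (K F : Type u) (_ : AddCommGroup K) (_ : AddCommGroup F) (_ : Module A K)
      (_ : Module A F) (i : K →ₗ[A] F) (p : F →ₗ[A] M), Module.Finite A F ∧ Module.Projective A F ∧
      Function.Injective i ∧ Function.Exact i p ∧ Function.Surjective p ∧ HasFP A k K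

variable {A : Type u} [Ring A]
variable {K L M : Type u} [AddCommGroup K] [Module A K] [AddCommGroup L] [Module A L]
  [AddCommGroup M] [Module A M]

theorem HasFP.of_presentation {k : ℕ} [Module.Finite A L] [Module.Projective A L]
    {i : K →ₗ[A] L} {p : L →ₗ[A] M} (hi : Function.Injective i) (hip : Function.Exact i p)
    (hp : Function.Surjective p) (hK : HasFP A k K) : HasFP A (k + 1) M :=
  ⟨K, L, _, _, _, _, i, p, inferInstance, inferInstance, hi, hip, hp, hK⟩

theorem HasFP.of_surjective {k : ℕ} [Module.Finite A L] [Module.Projective A L]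
    {p : L →ₗ[A] M} (hp : Function.Surjective p) (hK : HasFP A k (LinearMap.ker p)) :
    HasFP A (k + 1) M :=
  .of_presentation (Submodule.injective_subtype _) (LinearMap.exact_subtype_ker_map p) hp hK

theorem HasFP.of_linearEquiv {k : ℕ} (h : HasFP A k M) (e : M ≃ₗ[A] L) : HasFP A k L := by
  cases k with
  | zero => trivial
  | succ k =>
    obtain ⟨K, F, _, _, _, _, i, p, _, _, hi, hip, hp, hK⟩ := h
    refine .of_presentation (p := e.toLinearMap ∘ₗ p) hi ?_ (e.surjective.comp hp) hK
    exact hip.comp_injective _ e.injective (map_zero e)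

theorem HasFP.finite {k : ℕ} (h : HasFP A (k + 1) M) : Module.Finite A M := by
  obtain ⟨K, F, _, _, _, _, i, p, _, _, hi, hip, hp, hK⟩ := h
  exact Module.Finite.of_surjective p hp

theorem HasFP.of_succ {k : ℕ} (h : HasFP A (k + 1) M) : HasFP A k M := by
  induction k generalizing M with
  | zero => trivial
  | succ k ih =>
    obtain ⟨K, F, _, _, _, _, i, p, _, _, hi, hip, hp, hK⟩ := h
    exact .of_presentation hi hip hp (ih hK)

theorem HasFP.of_subsingleton [Subsingleton M] (k : ℕ) : HasFP A k M := by
  induction k generalizing M with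
  | zero => trivial
  | succ k ih =>
    exact .of_presentation (K := PUnit) (i := 0) (p := LinearMap.id (M := M))
      (fun _ _ _ => Subsingleton.elim _ _) (fun y => ⟨fun _ => ⟨0, Subsingleton.elim _ _⟩,
        fun _ => Subsingleton.elim _ _⟩) (fun x => ⟨x, rfl⟩) ih

theorem HasFP.of_finite_projective [Module.Finite A M] [Module.Projective A M] (k : ℕ) :
    HasFP A k M := by
  cases k with
  | zero => trivial
  | succ k =>
    refine .of_presentation (K := PUnit) (i := 0) (p := LinearMap.id (M := M))
      (fun _ _ _ => Subsingleton.elim _ _) (fun y => ⟨fun h => ⟨0, h.symm⟩, ?_⟩) (fun x => ⟨x, rfl⟩)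
      (.of_subsingleton k)
    rintro ⟨x, rfl⟩
    rfl

/-- The horseshoe lemma for modules of type `FP`. -/
theorem HasFP.of_extension {k : ℕ} {i : K →ₗ[A] L} {p : L →ₗ[A] M} (hi : Function.Injective i)
    (hip : Function.Exact i p) (hp : Function.Surjective p) (hK : HasFP A k K)
    (hM : HasFP A k M) : HasFP A k L := by
  induction k generalizing K L M with
  | zero => trivial
  | succ k ih =>
    obtain ⟨K₁, F₁, _, _, _, _, i₁, p₁, _, _, hi₁, hip₁, hp₁, hK₁⟩ := hK
    obtain ⟨K₂, F₂, _, _, _, _, i₂, p₂, _, _, hi₂, hip₂, hp₂, hK₂⟩ := hM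
    obtain ⟨s, hs⟩ := Module.projective_lifting_property p p₂ hp
    have hs' : ∀ x, p (s x) = p₂ x := fun x => LinearMap.congr_fun hs x
    have hpi := hip.apply_apply_eq_zero
    -- The horseshoe: `s` lifts `p₂` through `p`. The kernel of `q` is then an extension of `ker p₂
    -- ≅ K₂` by `K₁`, to which the induction applies.
    let q : F₁ × F₂ →ₗ[A] L := (i ∘ₗ p₁).coprod s
    have hq : ∀ x y, q (x, y) = i (p₁ x) + s y := fun x y => by simp [q]
    have hpq : ∀ x y, p (q (x, y)) = p₂ y := fun x y => by rw [hq, map_add, hpi, zero_add, hs']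
    have hqs : Function.Surjective q := by
      intro l
      obtain ⟨y, hy⟩ := hp₂ (p l)
      obtain ⟨a, ha⟩ := (hip (l - s y)).1 (by rw [map_sub, hs', hy, sub_self])
      obtain ⟨x, rfl⟩ := hp₁ a
      exact ⟨(x, y), by rw [hq, ha, sub_add_cancel]⟩
    refine .of_surjective hqs ?_
    let i' : K₁ →ₗ[A] LinearMap.ker q := (LinearMap.inl A F₁ F₂ ∘ₗ i₁).codRestrict _ fun x => by
      change q (i₁ x, 0) = 0
      rw [hq, hip₁.apply_apply_eq_zero, map_zero, map_zero, add_zero]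
    let p' : LinearMap.ker q →ₗ[A] LinearMap.ker p₂ :=
      (LinearMap.snd A F₁ F₂ ∘ₗ (LinearMap.ker q).subtype).codRestrict _ fun x => by
        change p₂ x.1.2 = 0
        rw [← hpq x.1.1, Prod.mk.eta, LinearMap.mem_ker.1 x.2, map_zero]
    let e : K₂ ≃ₗ[A] LinearMap.ker p₂ :=
      (LinearEquiv.ofInjective i₂ hi₂).trans (LinearEquiv.ofEq _ _ hip₂.linearMap_ker_eq.symm)
    refine ih (i := i') (p := p') ?_ ?_ ?_ hK₁ (hK₂.of_linearEquiv e)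
    · intro x y hxy
      exact hi₁ (congrArg (fun z => z.1.1) hxy)
    · rintro ⟨⟨x, y⟩, hz⟩
      rw [LinearMap.mem_ker, hq] at hz
      constructor
      · intro h
        obtain rfl : y = 0 := congrArg Subtype.val h
        obtain ⟨a, rfl⟩ := (hip₁ x).1 (hi (by simpa using hz))
        exact ⟨a, rfl⟩
      · rintro ⟨a, ha⟩
        exact Subtype.ext (congrArg (fun z => z.1.2) ha).symm
    · rintro ⟨y, hy⟩
      obtain ⟨a, ha⟩ := (hip (s y)).1 (by rw [hs', LinearMap.mem_ker.1 hy])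
      obtain ⟨x, rfl⟩ := hp₁ a
      refine ⟨⟨(-x, y), ?_⟩, rfl⟩
      rw [LinearMap.mem_ker, hq, map_neg, map_neg, ha, neg_add_cancel]

theorem HasFP.prod {k : ℕ} (hK : HasFP A k K) (hM : HasFP A k M) : HasFP A k (K × M) :=
  .of_extension (i := LinearMap.inl A K M) (p := LinearMap.snd A K M) LinearMap.inl_injective
    Function.Exact.inl_snd Prod.snd_surjective hK hM

/-- A quotient of a module of type `FP_k` by a submodule of type `FP_{k-1}` is of type `FP_k`. -/
theorem HasFP.of_quotient {k : ℕ} {i : K →ₗ[A] L} {p : L →ₗ[A] M} (hi : Function.Injective i)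
    (hip : Function.Exact i p) (hp : Function.Surjective p) (hK : HasFP A k K)
    (hL : HasFP A (k + 1) L) : HasFP A (k + 1) M := by
  obtain ⟨K₁, F₁, _, _, _, _, i₁, p₁, _, _, hi₁, hip₁, hp₁, hK₁⟩ := hL
  refine .of_surjective (p := p ∘ₗ p₁) (hp.comp hp₁) ?_
  have hpi := hip.apply_apply_eq_zero
  -- The kernel of `F₁ → L → M` is an extension of `ker p ≅ K` by `K₁`.
  let e : K ≃ₗ[A] LinearMap.ker p :=
    (LinearEquiv.ofInjective i hi).trans (LinearEquiv.ofEq _ _ hip.linearMap_ker_eq.symm)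
  let i' : K₁ →ₗ[A] LinearMap.ker (p ∘ₗ p₁) := i₁.codRestrict _ fun x => by
    rw [LinearMap.mem_ker, LinearMap.comp_apply, hip₁.apply_apply_eq_zero, map_zero]
  let p' : LinearMap.ker (p ∘ₗ p₁) →ₗ[A] LinearMap.ker p :=
    (p₁ ∘ₗ (LinearMap.ker (p ∘ₗ p₁)).subtype).codRestrict _ fun x => x.2
  refine HasFP.of_extension (i := i') (p := p') ?_ ?_ ?_ hK₁ (hK.of_linearEquiv e)
  · intro x y hxy
    exact hi₁ (congrArg Subtype.val hxy)
  · rintro ⟨x, hx⟩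
    constructor
    · intro h
      obtain ⟨a, rfl⟩ := (hip₁ x).1 (congrArg Subtype.val h)
      exact ⟨a, rfl⟩
    · rintro ⟨a, ha⟩
      refine Subtype.ext ?_
      obtain rfl : i₁ a = x := congrArg Subtype.val ha
      exact hip₁.apply_apply_eq_zero a
  · rintro ⟨y, hy⟩
    obtain ⟨x, rfl⟩ := hp₁ y
    exact ⟨⟨x, hy⟩, rfl⟩

/-- The kernel of a surjection from a module of type `FP_{k-1}` onto a module of type `FP_k` is of
type `FP_{k-1}`. -/
theorem HasFP.of_kernel {k : ℕ} {i : K →ₗ[A] L} {p : L →ₗ[A] M} (hi : Function.Injective i)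
    (hip : Function.Exact i p) (hp : Function.Surjective p) (hL : HasFP A k L)
    (hM : HasFP A (k + 1) M) : HasFP A k K := by
  cases k with
  | zero => trivial
  | succ k =>
  obtain ⟨K₂, F₂, _, _, _, _, i₂, p₂, _, _, hi₂, hip₂, hp₂, hK₂⟩ := hM
  obtain ⟨s, hs⟩ := Module.projective_lifting_property p p₂ hp
  have hs' : ∀ x, p (s x) = p₂ x := fun x => LinearMap.congr_fun hs x
  have hpi := hip.apply_apply_eq_zero
  -- `0 → K₂ → K × F₂ → L → 0` is exact, where `K × F₂` is the pullback of `L` and `F₂`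
  let q : K × F₂ →ₗ[A] L := i.coprod s
  have hq : ∀ x y, q (x, y) = i x + s y := fun x y => by simp [q]
  have hqs : Function.Surjective q := by
    intro l
    obtain ⟨y, hy⟩ := hp₂ (p l)
    obtain ⟨a, ha⟩ := (hip (l - s y)).1 (by rw [map_sub, hs', hy, sub_self])
    exact ⟨(a, y), by rw [hq, ha, sub_add_cancel]⟩
  let e : K₂ ≃ₗ[A] LinearMap.ker p₂ :=
    (LinearEquiv.ofInjective i₂ hi₂).trans (LinearEquiv.ofEq _ _ hip₂.linearMap_ker_eq.symm)
  have hbij : Function.Bijective ((LinearMap.snd A K F₂ ∘ₗ (LinearMap.ker q).subtype).codRestrict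
      (LinearMap.ker p₂) fun x => by
        have h := congrArg p (LinearMap.mem_ker.1 x.2)
        rw [← Prod.mk.eta (p := x.1), hq, map_add, hpi, zero_add, hs', map_zero] at h
        exact h) := by
    constructor
    · rintro ⟨⟨x, y⟩, hx⟩ ⟨⟨x', y'⟩, hx'⟩ h
      obtain rfl : y = y' := congrArg Subtype.val h
      rw [LinearMap.mem_ker, hq] at hx hx'
      obtain rfl : x = x' := hi (add_right_cancel (hx.trans hx'.symm))
      rfl
    · rintro ⟨y, hy⟩
      obtain ⟨a, ha⟩ := (hip (s y)).1 (by rw [hs', LinearMap.mem_ker.1 hy])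
      refine ⟨⟨(-a, y), ?_⟩, rfl⟩
      rw [LinearMap.mem_ker, hq, map_neg, ha, neg_add_cancel]
  -- The pullback `K × F₂` is an extension of `L` by `K₂`, hence of finite type; dividing out the
  -- finitely generated projective `F₂` leaves `K`.
  have hker : HasFP A (k + 1) (LinearMap.ker q) :=
    hK₂.of_linearEquiv (e.trans (LinearEquiv.ofBijective _ hbij).symm)
  have hprod : HasFP A (k + 1) (K × F₂) :=
    .of_extension (Submodule.injective_subtype _) (LinearMap.exact_subtype_ker_map q) hqs hker hL
  exact .of_quotient (i := LinearMap.inr A K F₂) (p := LinearMap.fst A K F₂)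
    LinearMap.inr_injective Function.Exact.inr_fst Prod.fst_surjective (.of_finite_projective k)
    hprod

/-- A module of type `FP` has a partial resolution by nonzero free modules. -/
theorem HasFP.exists_free {k : ℕ} (h : HasFP A (k + 1) M) :
    ∃ (r : ℕ) (p : (Fin (r + 1) → A) →ₗ[A] M), Function.Surjective p ∧
      HasFP A k (LinearMap.ker p) := by
  have := h.finite
  obtain ⟨r, p, hp⟩ := Module.Finite.exists_fin' A M
  -- A redundant last generator makes the free module a non-empty power of `A`, as closure under
  -- sums requires.
  let q : (Fin (r + 1) → A) →ₗ[A] M := p ∘ₗ LinearMap.funLeft A A Fin.castSucc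
  have hq : Function.Surjective q := hp.comp
    (LinearMap.funLeft_surjective_of_injective A A _ (Fin.castSucc_injective r))
  exact ⟨r, q, hq, .of_kernel (Submodule.injective_subtype _) (LinearMap.exact_subtype_ker_map q)
    hq (.of_finite_projective k) h⟩

end FiniteType

/-! ### Finite type as a bootstrappable property -/

section FiniteTypeComplex

variable {A : Type u} [Ring A]

/-- A complex whose chain modules are finitely generated in degrees `≤ n`. -/
def IsFiniteUpTo (n : ℤ) (X : ChainComplex (ModuleCat.{u} A) ℤ) : Prop :=
  ∀ j : ℤ, j ≤ n → Module.Finite A (X.X j)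

theorem isBootstrappable_isFiniteUpTo : IsBootstrappable (A := A) IsFiniteUpTo where
  of_iso n X Y := by
    rintro ⟨e⟩ h j hj
    have := h j hj
    exact Module.Finite.equiv (HomologicalComplex.Hom.isoApp e j).toLinearEquiv
  degree X hX m hm j hj := by
    have : Subsingleton (X.X j) := ModuleCat.subsingleton_of_isZero (hX j (by omega))
    infer_instance
  suspension_iff n X := by
    constructor
    · intro h j hj
      exact h (j - 1) (by omega)
    · intro h j hj
      have := h (j + 1) (by omega)
      have e : j + 1 - 1 = j := by ring
      have h' : Module.Finite A (X.X (j + 1 - 1)) := this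
      rwa [e] at h'
  cone n X Y f hX hY j hj := by
    have := hX (j - 1) (by omega)
    have := hY j hj
    exact Module.Finite.equiv (mappingConeEquiv f j (j - 1) (by ring)).symm

theorem isProjectiveResolution_single (F : Type u) [AddCommGroup F] [Module A F]
    [hF : Module.Projective A F] :
    IsProjectiveResolution ((HomologicalComplex.single _ (ComplexShape.down ℤ) 0).obj
      (ModuleCat.of A F)) (ModuleCat.of A F) where
  projective j := by
    by_cases hj : j = 0
    · subst hj
      exact Module.Projective.of_equiv (HomologicalComplex.singleObjXSelf (ComplexShape.down ℤ) 0
        (ModuleCat.of A F)).symm.toLinearEquiv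
    · have := ModuleCat.subsingleton_of_isZero
        (HomologicalComplex.isZero_single_obj_X (ComplexShape.down ℤ) 0 (ModuleCat.of A F) j hj)
      infer_instance
  nonneg j hj := HomologicalComplex.isZero_single_obj_X _ _ _ _ hj.ne
  exact j hj := HomologicalComplex.exactAt_single_obj _ _ _ _ hj
  homology_zero := ⟨HomologicalComplex.singleObjHomologySelfIso _ _ _⟩

theorem isFiniteUpTo_single (n : ℤ) (F : Type u) [AddCommGroup F] [Module A F]
    [hF : Module.Finite A F] : IsFiniteUpTo n
      ((HomologicalComplex.single _ (ComplexShape.down ℤ) 0).obj (ModuleCat.of A F)) := by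
  intro j _
  by_cases hj : j = 0
  · subst hj
    exact Module.Finite.equiv (HomologicalComplex.singleObjXSelf (ComplexShape.down ℤ) 0
      (ModuleCat.of A F)).symm.toLinearEquiv
  · have := ModuleCat.subsingleton_of_isZero
      (HomologicalComplex.isZero_single_obj_X (ComplexShape.down ℤ) 0 (ModuleCat.of A F) j hj)
    infer_instance

/-- The resolution is assembled by cones instead of splicing: `F` resolves itself, and the kernel is
handled by induction. -/
theorem HasFP.hasResolutionIn {k : ℕ} {M : Type u} [AddCommGroup M] [Module A M]
    (h : HasFP A k M) : HasResolutionIn (A := A) IsFiniteUpTo ((k : ℤ) - 1) M := by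
  induction k generalizing M with
  | zero => exact isBootstrappable_isFiniteUpTo.hasResolutionIn_of_neg (by simp) M
  | succ k ih =>
    obtain ⟨K, F, _, _, _, _, i, p, _, _, hi, hip, hp, hK⟩ := h
    exact isBootstrappable_isFiniteUpTo.hasResolutionIn_of_exact hi hip hp
      (by simpa using ih hK) ⟨_, isProjectiveResolution_single F, isFiniteUpTo_single _ F⟩

/-- For `j ≥ 0` the sequence `0 → P_{j+1}/im → P_j → P_j/im → 0` is exact. The `k` modules needed
are `P_j, …, P_{j+k-1}`, whence the bound `j + k ≤ n + 1`. -/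
theorem IsAugmentation.hasFP_syzygy {P : ChainComplex (ModuleCat.{u} A) ℤ} {M : Type u}
    [AddCommGroup M] [Module A M] {ε : P.X 0 →ₗ[A] M} (hε : IsAugmentation P ε)
    (hproj : ∀ j, Module.Projective A (P.X j)) {n : ℤ} (hP : IsFiniteUpTo n P) (k : ℕ) :
    ∀ j i : ℤ, j + 1 = i → 0 ≤ j → j + k ≤ n + 1 →
      HasFP A k (P.X j ⧸ LinearMap.range (P.d i j).hom) := by
  induction k with
  | zero => intros; trivial
  | succ k ih =>
    intro j i hij hj hk
    have := hP j (by push_cast at hk; omega)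
    have := hproj j
    have hK := ih i (i + 1) rfl (by omega) (by push_cast at hk; omega)
    have hex := hε.exact (i + 1) i j rfl hij (by omega)
    have hle : LinearMap.range (P.d (i + 1) i).hom ≤ LinearMap.ker (P.d i j).hom :=
      hex.linearMap_ker_eq.ge
    refine HasFP.of_presentation (i := Submodule.liftQ _ (P.d i j).hom hle)
      (p := Submodule.mkQ _) ?_ ?_ (Submodule.mkQ_surjective _) hK
    · rw [← LinearMap.ker_eq_bot]
      exact Submodule.ker_liftQ_eq_bot _ _ _ hex.linearMap_ker_eq.le
    · rw [LinearMap.exact_iff, Submodule.ker_mkQ, Submodule.range_liftQ]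

theorem HasResolutionIn.hasFP {k : ℕ} {M : Type u} [AddCommGroup M] [Module A M]
    (h : HasResolutionIn (A := A) IsFiniteUpTo ((k : ℤ) - 1) M) : HasFP A k M := by
  obtain ⟨P, hP, hfin⟩ := h
  obtain ⟨ε, hε⟩ := hP.exists_isAugmentation
  have h0 := hε.hasFP_syzygy hP.projective hfin k 0 1 (by simp) le_rfl (by simp)
  exact h0.of_linearEquiv ((Submodule.quotEquivOfEq _ _ hε.exact_zero.linearMap_ker_eq.symm).trans
    (ε.quotKerEquivOfSurjective hε.surjective))

end FiniteTypeComplex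

/-! ### Restriction of scalars -/

section RestrictedModule

variable {S A : Type u} [Ring S] [Ring A] (f : S →+* A)

/-- The restriction of scalars of the `A`-module `M` along `f : S → A`. -/
def RestrictedModule (_ : S →+* A) (M : Type u) : Type u := M

variable (M : Type u) {L K : Type u} [AddCommGroup M] [Module A M] [AddCommGroup L] [Module A L]
  [AddCommGroup K] [Module A K]

instance : AddCommGroup (RestrictedModule f M) := inferInstanceAs (AddCommGroup M)

instance : Module S (RestrictedModule f M) := Module.compHom M f

/-- The underlying additive group of the restriction of scalars. -/
def restrictedEquiv : M ≃+ RestrictedModule f M := AddEquiv.refl M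

theorem smul_restrictedEquiv (s : S) (x : M) :
    s • restrictedEquiv f M x = restrictedEquiv f M (f s • x) := rfl

variable {M}

/-- The restriction of scalars of a linear map. -/
def restrictedMap (g : M →ₗ[A] L) : RestrictedModule f M →ₗ[S] RestrictedModule f L where
  toFun x := restrictedEquiv f L (g ((restrictedEquiv f M).symm x))
  map_add' x y := g.map_add x y
  map_smul' s x := g.map_smul (f s) ((restrictedEquiv f M).symm x)

theorem finite_of_restrictedModule (h : Module.Finite S (RestrictedModule f M)) :
    Module.Finite A M := by
  obtain ⟨T, hT⟩ := h.fg_top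
  have hfin : (T : Set (RestrictedModule f M)).Finite := T.finite_toSet
  refine ⟨Submodule.fg_def.2 ⟨_, hfin.preimage (restrictedEquiv f M).injective.injOn,
    top_unique fun x _ => ?_⟩⟩
  set W := Submodule.span A (restrictedEquiv f M ⁻¹' (T : Set (RestrictedModule f M)))
  suffices ∀ y : RestrictedModule f M, (restrictedEquiv f M).symm y ∈ W from
    this (restrictedEquiv f M x)
  intro y
  have hy : y ∈ Submodule.span S (T : Set (RestrictedModule f M)) := hT ▸ Submodule.mem_top
  induction hy using Submodule.span_induction with
  | mem y hy => exact Submodule.subset_span hy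
  | zero => exact W.zero_mem
  | add x y _ _ hx hy => exact W.add_mem hx hy
  | smul s y _ hy => exact W.smul_mem (f s) hy

/-- Restriction of scalars commutes with finite powers. -/
def restrictedPiEquiv (r : ℕ) :
    (Fin r → RestrictedModule f M) ≃ₗ[S] RestrictedModule f (Fin r → M) where
  toFun x := x
  invFun x := x
  map_add' _ _ := rfl
  map_smul' _ _ := rfl
  left_inv _ := rfl
  right_inv _ := rfl

theorem restrictedMap_exact {g : K →ₗ[A] L} {h : L →ₗ[A] M} (H : Function.Exact g h) :
    Function.Exact (restrictedMap f g) (restrictedMap f h) := H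

theorem restrictedMap_injective {g : K →ₗ[A] L} (H : Function.Injective g) :
    Function.Injective (restrictedMap f g) := H

theorem restrictedMap_surjective {g : K →ₗ[A] L} (H : Function.Surjective g) :
    Function.Surjective (restrictedMap f g) := H

/-- If the restriction of `A` has resolutions in `B m` for all `m ≤ n`, then so has the restriction
of every module of type `FP_n`. -/
theorem IsBootstrappable.hasResolutionIn_restrictedModule
    {B : ℤ → ChainComplex (ModuleCat.{u} S) ℤ → Prop} (hB : IsBootstrappable B) {n : ℤ}
    (hA : ∀ m ≤ n, HasResolutionIn B m (RestrictedModule f A)) {k : ℕ} (hk : (k : ℤ) - 1 ≤ n)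
    (hM : HasFP A k M) : HasResolutionIn B ((k : ℤ) - 1) (RestrictedModule f M) := by
  induction k generalizing M with
  | zero => exact hB.hasResolutionIn_of_neg (by simp) _
  | succ k ih =>
    obtain ⟨r, p, hp, hK⟩ := hM.exists_free
    refine hB.hasResolutionIn_of_exact
      (restrictedMap_injective f (Submodule.injective_subtype (LinearMap.ker p)))
      (restrictedMap_exact f (LinearMap.exact_subtype_ker_map p)) (restrictedMap_surjective f hp)
      ?_ ?_
    · have := ih (by push_cast at hk; omega) hK
      simpa using this
    · exact (hB.hasResolutionIn_pi r _ fun _ => hA _ hk).of_linearEquiv (restrictedPiEquiv f _)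

theorem HasFP.of_le {k l : ℕ} (h : HasFP A k M) (hl : l ≤ k) : HasFP A l M := by
  induction hl using Nat.decreasingInduction with
  | self => exact h
  | of_succ _ _ ih => exact ih.of_succ

theorem HasFP.pi {k : ℕ} (h : HasFP A k M) (r : ℕ) : HasFP A k (Fin r → M) := by
  induction r with
  | zero => exact .of_subsingleton k
  | succ r ih => exact (h.prod ih).of_linearEquiv (Fin.consLinearEquiv A fun _ => M)

/-- Finiteness properties descend along a ring homomorphism `S → A` if `A` is of type `FP_{k-1}`
over `S`. -/
theorem HasFP.of_restrictedModule {k : ℕ} (hA : HasFP S k (RestrictedModule f A)) {l : ℕ}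
    (hl : l ≤ k + 1) (hM : HasFP S l (RestrictedModule f M)) : HasFP A l M := by
  induction l generalizing M with
  | zero => trivial
  | succ l ih =>
    have := finite_of_restrictedModule f hM.finite
    obtain ⟨r, p, hp⟩ := Module.Finite.exists_fin' A M
    refine .of_surjective hp (ih (by omega) ?_)
    -- Over `S` the power of `A` is of type `FP_{l-1}` because `l ≤ k`, so the kernel loses only one
    -- degree compared with `M`.
    exact .of_kernel (restrictedMap_injective f (Submodule.injective_subtype (LinearMap.ker p)))
      (restrictedMap_exact f (LinearMap.exact_subtype_ker_map p)) (restrictedMap_surjective f hp)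
      (((hA.of_le (by omega)).pi r).of_linearEquiv (restrictedPiEquiv f r)) hM

end RestrictedModule

/-! ### Trivial modules and permutation modules -/

section TrivialModule

variable (R : Type u) [Ring R] {Γ : Type u} [Group Γ] (Δ : Subgroup Γ)

/-- The underlying additive group of the trivial module. -/
def trivialEquiv (Γ : Type u) [Group Γ] : R ≃+ trivialModule R Γ := AddEquiv.refl R

theorem smul_trivialEquiv (a : MonoidAlgebra R Γ) (x : R) :
    a • trivialEquiv R Γ x = trivialEquiv R Γ (augmentation R Γ a * x) := rfl

theorem augmentation_single (γ : Γ) (r : R) :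
    augmentation R Γ (MonoidAlgebra.single γ r) = r := by
  simp [augmentation]

theorem single_smul_trivialEquiv (γ : Γ) (r x : R) :
    MonoidAlgebra.single γ r • trivialEquiv R Γ x = trivialEquiv R Γ (r * x) := by
  rw [smul_trivialEquiv, augmentation_single]

/-- The canonical generator of `RΓ ⊗_{RΔ} R`. -/
def inducedGen : InducedModule (subgroupRingHom R Δ) (trivialModule R Δ) :=
  inducedMk (subgroupRingHom R Δ) 1 (trivialEquiv R Δ 1)

theorem inducedMk_trivialEquiv (a : MonoidAlgebra R Γ) (x : R) :
    inducedMk (subgroupRingHom R Δ) a (trivialEquiv R Δ x) =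
      (a * MonoidAlgebra.single 1 x) • inducedGen R Δ := by
  have h : trivialEquiv R Δ x =
      (MonoidAlgebra.single 1 x : MonoidAlgebra R Δ) • trivialEquiv R Δ 1 := by
    rw [single_smul_trivialEquiv, mul_one]
  rw [h, inducedMk_smul, inducedGen, smul_inducedMk, mul_one]
  simp

variable {Δ} in
theorem single_smul_inducedGen {h : Γ} (hh : h ∈ Δ) :
    (MonoidAlgebra.single h 1 : MonoidAlgebra R Γ) • inducedGen R Δ = inducedGen R Δ := by
  have h1 : (MonoidAlgebra.single h 1 : MonoidAlgebra R Γ) =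
      1 * subgroupRingHom R Δ (MonoidAlgebra.single ⟨h, hh⟩ 1) := by simp
  rw [inducedGen, smul_inducedMk, mul_one, h1, ← inducedMk_smul, single_smul_trivialEquiv, mul_one]

variable {R Δ} {M : Type u} [AddCommGroup M] [Module (MonoidAlgebra R Γ) M]

/-- The linear map `RΓ ⊗_{RΔ} R → M` attached to an element of `M` fixed by `Δ`. -/
theorem exists_inducedTrivial_hom {m : M}
    (hm : ∀ h ∈ Δ, (MonoidAlgebra.single h 1 : MonoidAlgebra R Γ) • m = m) :
    ∃ p : InducedModule (subgroupRingHom R Δ) (trivialModule R Δ) →ₗ[MonoidAlgebra R Γ] M,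
      p (inducedGen R Δ) = m := by
  let g : trivialModule R Δ →ₛₗ[subgroupRingHom R Δ] M :=
    { toFun := fun x =>
        (MonoidAlgebra.single 1 ((trivialEquiv R Δ).symm x) : MonoidAlgebra R Γ) • m
      map_add' := fun x y => by rw [map_add, MonoidAlgebra.single_add, add_smul]
      map_smul' := fun s x => by
        obtain ⟨x, rfl⟩ := (trivialEquiv R Δ).surjective x
        induction s using MonoidAlgebra.induction_linear with
        | zero => simp
        | add s t hs ht =>
          rw [add_smul, map_add, MonoidAlgebra.single_add, add_smul, hs, ht, map_add, add_smul]
        | single h r =>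
          -- Group elements commute with coefficients in the group ring even though `R` need not be
          -- commutative; this moves `h` next to `m`, which it fixes.
          have e : (subgroupRingHom R Δ (MonoidAlgebra.single h r) : MonoidAlgebra R Γ) *
              MonoidAlgebra.single 1 x =
              MonoidAlgebra.single 1 (r * x) * MonoidAlgebra.single (h : Γ) 1 := by simp
          rw [single_smul_trivialEquiv, AddEquiv.symm_apply_apply, AddEquiv.symm_apply_apply,
            ← mul_smul, e, mul_smul, hm h h.2] }
  refine ⟨inducedLift _ g, ?_⟩
  rw [inducedGen, inducedLift_inducedMk, one_smul]
  change (MonoidAlgebra.single 1 (1 : R) : MonoidAlgebra R Γ) • m = m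
  rw [← MonoidAlgebra.one_def, one_smul]

variable (R) in
/-- The permutation module `R[Γ/N]` is induced from the trivial module of `N`. -/
theorem nonempty_inducedTrivial_linearEquiv (N : Subgroup Γ) [N.Normal] :
    Nonempty (InducedModule (subgroupRingHom R N) (trivialModule R N) ≃ₗ[MonoidAlgebra R Γ]
      RestrictedModule (MonoidAlgebra.mapDomainRingHom R (QuotientGroup.mk' N))
        (MonoidAlgebra R (Γ ⧸ N))) := by
  let π := MonoidAlgebra.mapDomainRingHom R (QuotientGroup.mk' N)
  obtain ⟨p, hp⟩ := exists_inducedTrivial_hom (Δ := N) (R := R)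
    (M := RestrictedModule π (MonoidAlgebra R (Γ ⧸ N))) (m := restrictedEquiv π _ 1)
    fun h hh => by
      rw [smul_restrictedEquiv, smul_eq_mul, mul_one]
      simp [π, (QuotientGroup.eq_one_iff h).2 hh, MonoidAlgebra.one_def]
  -- Both sides are `⨁_{Γ/N} R` additively, and `p` becomes the identity under these
  -- identifications; bijectivity follows.
  have key : ∀ x : (Γ ⧸ N) →₀ R, p (cosetSumToInduced R N (trivialModule R N)
      (x.mapRange (trivialEquiv R N) (map_zero _))) =
        restrictedEquiv π _ (MonoidAlgebra.coeffAddEquiv.symm x) := by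
    intro x
    induction x using Finsupp.induction_linear with
    | zero => simp
    | add x y hx hy =>
      rw [Finsupp.mapRange_add (map_add _), map_add, map_add, hx, hy, map_add, map_add]
    | single q r =>
      rw [Finsupp.mapRange_single, cosetSumToInduced_single, inducedMk_trivialEquiv, map_smul, hp,
        smul_restrictedEquiv, smul_eq_mul, mul_one]
      simp [π]
  have hbij : Function.Bijective p := by
    have h1 : Function.Bijective (Finsupp.mapRange (α := Γ ⧸ N) (trivialEquiv R N) (map_zero _)) :=
      (Finsupp.mapRange.addEquiv (trivialEquiv R N)).bijective
    have h2 : Function.Bijective (cosetSumToInduced R N (trivialModule R N)) :=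
      ⟨cosetSumToInduced_injective R N _, cosetSumToInduced_surjective R N _⟩
    have h3 : Function.Bijective (p ∘ (cosetSumToInduced R N (trivialModule R N) ∘
        Finsupp.mapRange (α := Γ ⧸ N) (trivialEquiv R N) (map_zero _))) := by
      have : (p ∘ (cosetSumToInduced R N (trivialModule R N) ∘
        Finsupp.mapRange (α := Γ ⧸ N) (trivialEquiv R N) (map_zero _))) =
          MonoidAlgebra.coeffAddEquiv.symm.trans (restrictedEquiv π _) := funext key
      rw [this]
      exact AddEquiv.bijective _
    exact (Function.Bijective.of_comp_iff p (h2.comp h1)).1 h3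
  exact ⟨LinearEquiv.ofBijective p hbij⟩

/-- The restriction of the trivial module of a quotient group is the trivial module. -/
def restrictedTrivialEquiv (N : Subgroup Γ) [N.Normal] :
    RestrictedModule (MonoidAlgebra.mapDomainRingHom R (QuotientGroup.mk' N))
      (trivialModule R (Γ ⧸ N)) ≃ₗ[MonoidAlgebra R Γ] trivialModule R Γ :=
  { (trivialEquiv R (Γ ⧸ N)).symm.trans (trivialEquiv R Γ) with
    map_smul' := fun a x => by
      have h : (augmentation R (Γ ⧸ N)).comp
          (MonoidAlgebra.mapDomainRingHom R (QuotientGroup.mk' N)) = augmentation R Γ := by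
        refine MonoidAlgebra.ringHom_ext (fun r => ?_) fun γ => ?_ <;>
        simp [augmentation_single]
      exact congrArg (fun g : MonoidAlgebra R Γ →+* R => g a * (trivialEquiv R (Γ ⧸ N)).symm x) h }

end TrivialModule

/-! ### Group extensions -/

section Extensions

variable {R : Type u} [Ring R]

theorem isOfTypeFP_iff_hasResolutionIn {n : ℤ} {Γ : Type u} [Group Γ] :
    IsOfTypeFP R n Γ ↔ HasResolutionIn (A := MonoidAlgebra R Γ) IsFiniteUpTo n (trivialModule R Γ) :=
  Iff.rfl

theorem isOfTypeFP_iff_hasFP {k : ℕ} {Γ : Type u} [Group Γ] :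
    IsOfTypeFP R ((k : ℤ) - 1) Γ ↔ HasFP (MonoidAlgebra R Γ) k (trivialModule R Γ) :=
  ⟨fun h => HasResolutionIn.hasFP h, fun h => h.hasResolutionIn⟩

theorem isOfTypeFP_of_neg {n : ℤ} (hn : n < 0) (Γ : Type u) [Group Γ] : IsOfTypeFP R n Γ :=
  isOfTypeFP_iff_hasResolutionIn.2 (isBootstrappable_isFiniteUpTo.hasResolutionIn_of_neg hn _)

theorem isOfTypeFP_of_forall_hasFP {Γ : Type u} [Group Γ]
    (h : ∀ k, HasFP (MonoidAlgebra R Γ) k (trivialModule R Γ)) (n : ℤ) : IsOfTypeFP R n Γ := by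
  rcases lt_or_ge n 0 with hn | hn
  · exact isOfTypeFP_of_neg hn Γ
  · obtain ⟨k, rfl⟩ := Int.eq_ofNat_of_zero_le hn
    have := isOfTypeFP_iff_hasFP.2 (h (k + 1))
    simpa using this

/-- The class of all groups. -/
def allGroups : ISClass.{u} where
  Mem _ := True
  of_mulEquiv _ _ _ _ _ _ := trivial
  of_subgroup _ _ _ _ := trivial

variable (R) in
theorem isEquivariantlyBootstrappable_isFiniteUpTo :
    IsEquivariantlyBootstrappable R allGroups.{u} fun _ _ => IsFiniteUpTo where
  bootstrappable _ _ _ := isBootstrappable_isFiniteUpTo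
  induction n Γ _ _ Δ X hX j hj := by
    have := hX j hj
    exact inducedModule_finite (subgroupRingHom R Δ) (M := X.X j)

variable {C : ISClass.{u}}
  {E : ∀ (Γ : Type u) [Group Γ], ℤ → ChainComplex (ModuleCat.{u} (MonoidAlgebra R Γ)) ℤ → Prop}

/-- Bootstrappable properties pass from normal subgroups to extensions by quotients of type
`FP_n`. -/
theorem IsEquivariantlyBootstrappable.hasResolutionIn_of_extension
    (hE : IsEquivariantlyBootstrappable R C E) {Γ : Type u} [Group Γ] (hΓ : C.Mem Γ)
    (N : Subgroup Γ) [N.Normal] {n : ℤ} (hQ : IsOfTypeFP R n (Γ ⧸ N))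
    (hN : ∀ m ≤ n, HasResolutionIn (E N) m (trivialModule R N)) :
    HasResolutionIn (E Γ) n (trivialModule R Γ) := by
  rcases lt_or_ge n 0 with hn | hn
  · exact (hE.bootstrappable Γ hΓ).hasResolutionIn_of_neg hn _
  obtain ⟨k, rfl⟩ := Int.eq_ofNat_of_zero_le hn
  obtain ⟨e⟩ := nonempty_inducedTrivial_linearEquiv R N
  have hQ' : HasFP (MonoidAlgebra R (Γ ⧸ N)) (k + 1) (trivialModule R (Γ ⧸ N)) :=
    isOfTypeFP_iff_hasFP.1 (by simpa using hQ)
  -- Over `RΓ` the ring `R[Γ/N]` is induced from the trivial module of `N`, so it has resolutions in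
  -- all degrees `m ≤ n`.
  have h := (hE.bootstrappable Γ hΓ).hasResolutionIn_restrictedModule _ (n := k)
    (fun m hm => (hE.hasResolutionIn_induced R N hΓ (hN m hm)).of_linearEquiv e)
    (by simp) hQ'
  simpa using h.of_linearEquiv (restrictedTrivialEquiv N)

/-- Induction from `N` makes `R[Γ/N]` of type `FP_{n-1}` over `RΓ`, which suffices for `FP_n` of the
trivial module to descend from `RΓ` to `R[Γ/N]`. -/
theorem IsOfTypeFP.quotient {Γ : Type u} [Group Γ] (N : Subgroup Γ) [N.Normal] {n : ℤ}
    (hΓ : IsOfTypeFP R n Γ) (hN : IsOfTypeFP R (n - 1) N) : IsOfTypeFP R n (Γ ⧸ N) := by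
  rcases lt_or_ge n 0 with hn | hn
  · exact isOfTypeFP_of_neg hn _
  obtain ⟨k, rfl⟩ := Int.eq_ofNat_of_zero_le hn
  obtain ⟨e⟩ := nonempty_inducedTrivial_linearEquiv R N
  have hΓ' : HasFP (MonoidAlgebra R Γ) (k + 1) (trivialModule R Γ) :=
    isOfTypeFP_iff_hasFP.1 (by simpa using hΓ)
  have hind := (isEquivariantlyBootstrappable_isFiniteUpTo R).hasResolutionIn_induced R N trivial
    (isOfTypeFP_iff_hasResolutionIn.1 hN)
  have h := HasFP.of_restrictedModule _ (HasResolutionIn.hasFP (hind.of_linearEquiv e)) le_rfl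
    (hΓ'.of_linearEquiv (restrictedTrivialEquiv N).symm)
  have := isOfTypeFP_iff_hasFP.2 h
  simpa using this

/-- The extension theorem applied to finite generation as the bootstrappable property. -/
theorem IsOfTypeFP.of_extension {Γ : Type u} [Group Γ] (N : Subgroup Γ) [N.Normal] {n : ℤ}
    (hQ : IsOfTypeFP R n (Γ ⧸ N)) (hN : ∀ m, IsOfTypeFP R m N) : IsOfTypeFP R n Γ :=
  isOfTypeFP_iff_hasResolutionIn.2
    ((isEquivariantlyBootstrappable_isFiniteUpTo R).hasResolutionIn_of_extension trivial N hQ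
      fun m _ => isOfTypeFP_iff_hasResolutionIn.1 (hN m))

end Extensions

/-! ### Finite groups -/

section FiniteGroups

/-- If `A` is finitely generated projective over `S`, then so are all syzygies of a module that is
finitely generated projective over `S`. -/
theorem HasFP.of_restrictedModule_projective {S A : Type u} [Ring S] [Ring A] (f : S →+* A)
    [Module.Finite S (RestrictedModule f A)] [Module.Projective S (RestrictedModule f A)]
    {M : Type u} [AddCommGroup M] [Module A M] [hfin : Module.Finite S (RestrictedModule f M)]
    [Module.Projective S (RestrictedModule f M)] (k : ℕ) : HasFP A k M := by
  induction k generalizing M with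
  | zero => trivial
  | succ k ih =>
    have := finite_of_restrictedModule f hfin
    obtain ⟨r, p, hp⟩ := Module.Finite.exists_fin' A M
    have : Module.Finite S (RestrictedModule f (Fin r → A)) :=
      Module.Finite.equiv (restrictedPiEquiv f r)
    have : Module.Projective S (RestrictedModule f (Fin r → A)) :=
      Module.Projective.of_equiv
        ((DFinsupp.linearEquivFunOnFintype (R := S) (M := fun _ : Fin r =>
          RestrictedModule f A)).trans (restrictedPiEquiv f r))
    obtain ⟨s, hs⟩ := Module.projective_lifting_property (restrictedMap f p) LinearMap.id
      (restrictedMap_surjective f hp)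
    let i := restrictedMap f (LinearMap.ker p).subtype
    have hi : Function.Injective i := restrictedMap_injective f (Submodule.injective_subtype _)
    have hex : Function.Exact i (restrictedMap f p) :=
      restrictedMap_exact f (LinearMap.exact_subtype_ker_map p)
    let e := (LinearEquiv.ofInjective i hi).symm
    -- Over `S` the section `s` splits `p`, and `id - s ∘ p` retracts onto the kernel, which is thus
    -- again finitely generated projective over `S`.
    let q : RestrictedModule f (Fin r → A) →ₗ[S] RestrictedModule f (LinearMap.ker p) :=
      e.toLinearMap ∘ₗ (LinearMap.id - s ∘ₗ restrictedMap f p).codRestrict _ fun x => (hex _).1 (by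
        have := LinearMap.congr_fun hs (restrictedMap f p x)
        simp only [LinearMap.comp_apply, LinearMap.id_apply] at this
        simp [this])
    have hq : q ∘ₗ i = LinearMap.id := by
      refine LinearMap.ext fun x => e.symm.injective (Subtype.ext ?_)
      have : i x - s (restrictedMap f p (i x)) = i x := by
        rw [hex.apply_apply_eq_zero, map_zero, sub_zero]
      refine Eq.trans ?_ this
      exact congrArg Subtype.val (e.symm_apply_apply _)
    have : Module.Finite S (RestrictedModule f (LinearMap.ker p)) :=
      Module.Finite.of_surjective q fun x => ⟨i x, LinearMap.congr_fun hq x⟩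
    have : Module.Projective S (RestrictedModule f (LinearMap.ker p)) :=
      Module.Projective.of_split i q hq
    exact .of_surjective hp ih

variable {R : Type u} [Ring R]

/-- Finite groups are of type `FP_n` for all `n`. -/
theorem isOfTypeFP_of_finite {Q : Type u} [Group Q] [Finite Q] (n : ℤ) : IsOfTypeFP R n Q := by
  let f : R →+* MonoidAlgebra R Q := MonoidAlgebra.singleOneRingHom
  let e₁ : (Q →₀ R) ≃ₗ[R] RestrictedModule f (MonoidAlgebra R Q) :=
    { MonoidAlgebra.coeffAddEquiv.symm.trans (restrictedEquiv f _) with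
      map_smul' := fun r x => by
        change restrictedEquiv f _ (MonoidAlgebra.ofCoeff (r • x)) =
          r • restrictedEquiv f _ (MonoidAlgebra.ofCoeff x)
        rw [smul_restrictedEquiv]
        congr 1
        ext q
        simp [f] }
  let e₂ : R ≃ₗ[R] RestrictedModule f (trivialModule R Q) :=
    { (trivialEquiv R Q).trans (restrictedEquiv f _) with
      map_smul' := fun r x => by
        change restrictedEquiv f _ (trivialEquiv R Q (r * x)) =
          r • restrictedEquiv f _ (trivialEquiv R Q x)
        rw [smul_restrictedEquiv, smul_trivialEquiv]
        simp [f, augmentation_single] }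
  have := Module.Finite.equiv e₁
  have := Module.Projective.of_equiv e₁
  have := Module.Finite.equiv e₂
  have := Module.Projective.of_equiv e₂
  exact isOfTypeFP_of_forall_hasFP (fun k => .of_restrictedModule_projective f k) n

end FiniteGroups

/-! ### Free abelian groups -/

section FreeAbelian

variable {R : Type u} [Ring R]

/-- Infinite cyclic groups are of type `FP_n` for all `n`. -/
theorem isOfTypeFP_of_mulEquiv_int {Γ : Type u} [Group Γ] (e : Γ ≃* Multiplicative ℤ) (n : ℤ) :
    IsOfTypeFP R n Γ := by
  obtain ⟨t, ht⟩ : ∃ t, e t = Multiplicative.ofAdd 1 := e.surjective _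
  have hpow : ∀ k : ℕ, e (t ^ k) = Multiplicative.ofAdd (k : ℤ) := fun k => by
    rw [map_pow, ht, ← ofAdd_nsmul, nsmul_one]
  have hgen : ∀ γ : Γ, γ ∈ Subgroup.zpowers t := fun γ =>
    ⟨Multiplicative.toAdd (e γ), e.injective (by
      change e (t ^ _) = _
      rw [map_zpow, ht, ← ofAdd_zsmul, zsmul_one]
      rfl)⟩
  -- The resolution is `0 → RΓ → RΓ → R → 0` with right multiplication by `t - 1`, where `t` is a
  -- generator.
  let d : MonoidAlgebra R Γ := MonoidAlgebra.single t 1 - 1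
  let i := LinearMap.toSpanSingleton (MonoidAlgebra R Γ) (MonoidAlgebra R Γ) d
  let p := LinearMap.toSpanSingleton (MonoidAlgebra R Γ) (trivialModule R Γ) (trivialEquiv R Γ 1)
  have hi : ∀ x, i x = x * MonoidAlgebra.single t 1 - x := fun x => by simp [i, d, mul_sub]
  have hp : ∀ x, p x = trivialEquiv R Γ (augmentation R Γ x) := fun x => by
    simp [p, smul_trivialEquiv]
  have hinj : Function.Injective i := by
    refine (injective_iff_map_eq_zero i).2 fun x hx => ?_
    rw [hi, sub_eq_zero] at hx
    have hshift : ∀ γ, x.coeff (γ * t⁻¹) = x.coeff γ := fun γ => by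
      have := congrArg (fun y => y.coeff γ) hx
      simpa using this
    -- Coefficients of an element of the kernel are constant along the infinite set of all `γ t^k`,
    -- which contradicts finite support unless they vanish.
    have hall : ∀ (k : ℕ) γ, x.coeff (γ * t ^ k) = x.coeff γ := by
      intro k
      induction k with
      | zero => simp
      | succ k ih => intro γ; rw [pow_succ, ← mul_assoc, ← hshift, mul_inv_cancel_right, ih]
    ext γ
    by_contra hγ
    refine Set.infinite_of_injective_forall_mem (f := fun k : ℕ => γ * t ^ k) ?_ (fun k => ?_)
      x.coeff.support.finite_toSet
    · intro k l hkl
      have h := congrArg e (mul_left_cancel hkl)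
      rw [hpow, hpow] at h
      exact_mod_cast Multiplicative.ofAdd.injective h
    · rw [Finset.mem_coe, Finsupp.mem_support_iff, hall]
      exact hγ
  have hexact : Function.Exact i p := by
    intro x
    rw [hp]
    constructor
    · intro hx
      -- The `γ` with `γ - 1` in the left ideal generated by `t - 1` form a subgroup containing `t`.
      -- Hence `x` is congruent to its augmentation modulo this ideal.
      let H : Subgroup Γ :=
        { carrier := {γ | (MonoidAlgebra.single γ 1 - 1 : MonoidAlgebra R Γ) ∈ LinearMap.range i}
          one_mem' := ⟨0, by rw [map_zero, MonoidAlgebra.one_def, sub_self]⟩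
          mul_mem' := fun {γ δ} hγ hδ => by
            have : (MonoidAlgebra.single (γ * δ) 1 - 1 : MonoidAlgebra R Γ) =
                (MonoidAlgebra.single γ 1 : MonoidAlgebra R Γ) • (MonoidAlgebra.single δ 1 - 1) +
                  (MonoidAlgebra.single γ 1 - 1) := by simp [mul_sub]
            rw [Set.mem_ofPred_eq, this]
            exact Submodule.add_mem _ (Submodule.smul_mem _ _ hδ) hγ
          inv_mem' := fun {γ} hγ => by
            have : (MonoidAlgebra.single γ⁻¹ 1 - 1 : MonoidAlgebra R Γ) =
                (-MonoidAlgebra.single γ⁻¹ 1 : MonoidAlgebra R Γ) •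
                  (MonoidAlgebra.single γ 1 - 1) := by
              simp [mul_sub, MonoidAlgebra.one_def]
              abel
            rw [Set.mem_ofPred_eq, this]
            exact Submodule.smul_mem _ _ hγ }
      have hH : ∀ γ, γ ∈ H := fun γ =>
        (Subgroup.zpowers_le.2 (show t ∈ H from ⟨1, by simp [i, d]⟩)) (hgen γ)
      have key : x - MonoidAlgebra.single 1 (augmentation R Γ x) ∈ LinearMap.range i := by
        clear hx
        induction x using MonoidAlgebra.induction_linear with
        | zero => simp
        | add x y hx hy =>
          rw [map_add, MonoidAlgebra.single_add, add_sub_add_comm]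
          exact Submodule.add_mem _ hx hy
        | single γ r =>
          have : (MonoidAlgebra.single γ r - MonoidAlgebra.single 1 r : MonoidAlgebra R Γ) =
              (MonoidAlgebra.single 1 r : MonoidAlgebra R Γ) • (MonoidAlgebra.single γ 1 - 1) := by
            simp [mul_sub]
          rw [augmentation_single, this]
          exact Submodule.smul_mem _ _ (hH γ)
      rw [(trivialEquiv R Γ).map_eq_zero_iff.1 hx, MonoidAlgebra.single_zero, sub_zero] at key
      exact key
    · rintro ⟨y, rfl⟩
      rw [hi, map_sub, map_mul, augmentation_single, mul_one, sub_self, map_zero]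
  have hsurj : Function.Surjective p := fun y => by
    obtain ⟨r, rfl⟩ := (trivialEquiv R Γ).surjective y
    exact ⟨MonoidAlgebra.single 1 r, by rw [hp, augmentation_single]⟩
  refine isOfTypeFP_of_forall_hasFP (fun k => ?_) n
  cases k with
  | zero => trivial
  | succ k => exact .of_presentation hinj hexact hsurj (.of_finite_projective k)

/-- A free abelian group of rank `k + 1` is an extension of one of rank `k` by an infinite cyclic
group. -/
theorem exists_normal_mulEquiv_int {Γ : Type u} [Group Γ] {k : ℕ}
    (e : Γ ≃* Multiplicative (Fin (k + 1) → ℤ)) :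
    ∃ (N : Subgroup Γ) (_ : N.Normal), Nonempty (N ≃* Multiplicative ℤ) ∧
      Nonempty (Γ ⧸ N ≃* Multiplicative (Fin k → ℤ)) := by
  -- `N` is the kernel of forgetting coordinate 0, and coordinate 0 identifies `N` with `ℤ`.
  let tail : (Fin (k + 1) → ℤ) →+ (Fin k → ℤ) :=
    { toFun := Fin.tail, map_zero' := rfl, map_add' := fun _ _ => rfl }
  let τ : Γ →* Multiplicative (Fin k → ℤ) := (AddMonoidHom.toMultiplicative tail).comp e.toMonoidHom
  let η : Γ →* Multiplicative ℤ :=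
    (AddMonoidHom.toMultiplicative (Pi.evalAddMonoidHom (fun _ : Fin (k + 1) => ℤ) 0)).comp
      e.toMonoidHom
  have hτ : Function.Surjective τ := fun y =>
    ⟨e.symm (Multiplicative.ofAdd (Fin.cons 0 y.toAdd)), by
      change Multiplicative.ofAdd (Fin.tail (e (e.symm _)).toAdd) = y
      rw [e.apply_symm_apply]
      rfl⟩
  refine ⟨τ.ker, inferInstance, ⟨MulEquiv.ofBijective (η.comp τ.ker.subtype) ⟨?_, fun y => ?_⟩⟩,
    ⟨QuotientGroup.quotientKerEquivOfSurjective τ hτ⟩⟩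
  · refine (injective_iff_map_eq_one _).2 fun x hx => Subtype.ext (e.injective ?_)
    have h0 : (e x.1).toAdd 0 = 0 := hx
    have h1 : Fin.tail (e x.1).toAdd = 0 := x.2
    rw [Subgroup.coe_one, map_one]
    refine Multiplicative.toAdd.injective (funext fun j => ?_)
    refine Fin.cases h0 (fun j => congrFun h1 j) j
  · refine ⟨⟨e.symm (Multiplicative.ofAdd (Fin.cons y.toAdd 0)), ?_⟩, ?_⟩
    · rw [MonoidHom.mem_ker]
      change Multiplicative.ofAdd (Fin.tail (e (e.symm _)).toAdd) = 1
      rw [e.apply_symm_apply]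
      rfl
    · simp [η]

theorem isOfTypeFP_of_mulEquiv_pi_int {k : ℕ} {Γ : Type u} [Group Γ]
    (e : Γ ≃* Multiplicative (Fin k → ℤ)) (n : ℤ) : IsOfTypeFP R n Γ := by
  induction k generalizing Γ with
  | zero =>
    have : Finite Γ := Finite.of_equiv _ e.symm.toEquiv
    exact isOfTypeFP_of_finite n
  | succ k ih =>
    obtain ⟨N, _, ⟨e₁⟩, ⟨e₂⟩⟩ := exists_normal_mulEquiv_int e
    exact .of_extension N (ih e₂) fun m => isOfTypeFP_of_mulEquiv_int e₁ m

end FreeAbelian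

/-! ### Graphs of groups: forests, universal property, embedding of vertex groups -/

namespace GraphOfGroups

variable {V : Type v} {E : Type w} (G : GraphOfGroups.{u, v, w} V E)

section Trees

theorem Joined.mono {S T : Set E} (h : S ⊆ T) {x y : V} (hxy : G.Joined S x y) :
    G.Joined T x y :=
  Relation.EqvGen.mono (fun _ _ ⟨e, he, h'⟩ => ⟨e, h he, h'⟩) _ _ hxy

/-- Every function from the edges of a forest to a group is a coboundary. -/
theorem exists_potential {H : Type*} [Group H] (t : E → H) {T : Set E} (hT : T.Finite)
    (hacyc : ∀ e ∈ T, ¬ G.Joined (T \ {e}) (G.src e) (G.tgt e)) :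
    ∃ c : V → H, ∀ e ∈ T, c (G.src e) * t e = c (G.tgt e) := by
  classical
  induction T, hT using Set.Finite.induction_on with
  | empty => exact ⟨1, fun e he => he.elim⟩
  | @insert e T he _ ih =>
    obtain ⟨c, hc⟩ := ih fun e' he' h => hacyc e' (Set.mem_insert_of_mem _ he')
      (h.mono G (Set.sdiff_subset_sdiff_left (Set.subset_insert _ _)))
    have hsrc : ¬ G.Joined T (G.tgt e) (G.src e) := fun h => by
      refine hacyc e (Set.mem_insert _ _) ?_
      rw [Set.insert_sdiff_of_mem _ (Set.mem_singleton e), Set.sdiff_singleton_eq_self he]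
      exact Relation.EqvGen.symm _ _ h
    -- Without `e` its endpoints lie in different components, so left multiplication of `c` by a
    -- constant on the component of `tgt e` corrects the equation at `e`. Edges of `T` stay within
    -- one component and are unaffected.
    refine ⟨fun x => if G.Joined T (G.tgt e) x then
      c (G.src e) * t e * (c (G.tgt e))⁻¹ * c x else c x, ?_⟩
    rintro e' (rfl | he')
    · have : G.Joined T (G.tgt e') (G.tgt e') := Relation.EqvGen.refl _
      simp [hsrc, this]
    · have h1 : G.Joined T (G.src e') (G.tgt e') := Relation.EqvGen.rel _ _ ⟨e', he', rfl, rfl⟩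
      have h2 : G.Joined T (G.tgt e) (G.src e') ↔ G.Joined T (G.tgt e) (G.tgt e') :=
        ⟨fun h => Relation.EqvGen.trans _ _ _ h h1,
          fun h => Relation.EqvGen.trans _ _ _ h (Relation.EqvGen.symm _ _ h1)⟩
      by_cases h : G.Joined T (G.tgt e) (G.tgt e')
      · simp only [h2, h, if_true]
        rw [mul_assoc _ (c _) (t e'), hc e' he']
      · simp only [h2, h, if_false]
        exact hc e' he'

end Trees

section UniversalProperty

variable {G} {T : Set E} {Γ : Type*} [Group Γ] (f : Γ ≃* G.fundamentalGroup T)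

/-- The homomorphism from a vertex group to a group identified with the fundamental group. -/
def vertexHom (x : V) : G.vertexGroup x →* Γ :=
  f.symm.toMonoidHom.comp ((QuotientGroup.mk' (Subgroup.normalClosure (G.relators T))).comp
    (Monoid.Coprod.inl.comp Monoid.CoprodI.of))

/-- The stable letter of an edge in a group identified with the fundamental group. -/
def stableLetter (e : E) : Γ := f.symm (QuotientGroup.mk (G.edgeElem e))

theorem stableLetter_conj (e : E) (a : G.edgeGroup e) :
    stableLetter f e * vertexHom f (G.tgt e) (G.tgtHom e a) * (stableLetter f e)⁻¹ =
      vertexHom f (G.src e) (G.srcHom e a) := by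
  have h : G.edgeElem e * G.vertexElem (G.tgt e) (G.tgtHom e a) * (G.edgeElem e)⁻¹ *
      (G.vertexElem (G.src e) (G.srcHom e a))⁻¹ ∈ Subgroup.normalClosure (G.relators T) :=
    Subgroup.subset_normalClosure (Or.inl ⟨e, a, rfl⟩)
  have h' := congrArg f.symm
    ((QuotientGroup.eq_one_iff (N := Subgroup.normalClosure (G.relators T)) _).2 h)
  rw [map_one, QuotientGroup.mk_mul, QuotientGroup.mk_mul, QuotientGroup.mk_mul,
    QuotientGroup.mk_inv, QuotientGroup.mk_inv, map_mul, map_mul, map_mul, map_inv, map_inv,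
    mul_inv_eq_one] at h'
  exact h'

theorem stableLetter_eq_one {e : E} (he : e ∈ T) : stableLetter f e = 1 := by
  have h : G.edgeElem e ∈ Subgroup.normalClosure (G.relators T) :=
    Subgroup.subset_normalClosure (Or.inr ⟨e, he, rfl⟩)
  have h' := (QuotientGroup.eq_one_iff (N := Subgroup.normalClosure (G.relators T)) _).2 h
  rw [stableLetter, h', map_one]

theorem eq_top_of_generators_mem {K : Subgroup Γ} (hv : ∀ x g, vertexHom f x g ∈ K)
    (he : ∀ e, stableLetter f e ∈ K) : K = ⊤ := by
  let π : G.FreeProd →* Γ :=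
    f.symm.toMonoidHom.comp (QuotientGroup.mk' (Subgroup.normalClosure (G.relators T)))
  have hπ : Function.Surjective π := f.symm.surjective.comp (QuotientGroup.mk'_surjective _)
  refine top_unique fun γ _ => ?_
  obtain ⟨x, rfl⟩ := hπ γ
  induction x using Monoid.Coprod.induction_on with
  | inl x =>
    induction x using Monoid.CoprodI.induction_on with
    | one => simp
    | of x g => exact hv x g
    | mul x y hx hy =>
      rw [map_mul, map_mul]
      exact K.mul_mem (hx trivial) (hy trivial)
  | inr x =>
    induction x using FreeGroup.induction_on with
    | C1 => simp
    | of e => exact he e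
    | inv_of e h =>
      rw [map_inv, map_inv]
      exact K.inv_mem (h trivial)
    | mul x y hx hy =>
      rw [map_mul, map_mul]
      exact K.mul_mem (hx trivial) (hy trivial)
  | mul x y hx hy =>
    rw [map_mul]
    exact K.mul_mem (hx trivial) (hy trivial)

/-- The universal property of the fundamental group of a graph of groups. -/
theorem exists_hom {H : Type*} [Group H] (φ : ∀ x, G.vertexGroup x →* H) (s : E → H)
    (hs : ∀ e a, s e * φ (G.tgt e) (G.tgtHom e a) * (s e)⁻¹ = φ (G.src e) (G.srcHom e a))
    (hT : ∀ e ∈ T, s e = 1) :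
    ∃ Φ : Γ →* H, (∀ x g, Φ (vertexHom f x g) = φ x g) ∧ ∀ e, Φ (stableLetter f e) = s e := by
  let ψ : G.FreeProd →* H := Monoid.Coprod.lift (Monoid.CoprodI.lift φ) (FreeGroup.lift s)
  have hv : ∀ x g, ψ (G.vertexElem x g) = φ x g := fun x g => by simp [ψ, vertexElem]
  have he : ∀ e, ψ (G.edgeElem e) = s e := fun e => by simp [ψ, edgeElem]
  have hker : Subgroup.normalClosure (G.relators T) ≤ ψ.ker := by
    refine Subgroup.normalClosure_le_normal ?_
    rintro _ (⟨e, a, rfl⟩ | ⟨e, h, rfl⟩)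
    · change ψ _ = 1
      rw [map_mul, map_mul, map_mul, map_inv, map_inv, hv, hv, he, hs, mul_inv_cancel]
    · exact (he e).trans (hT e h)
  refine ⟨(QuotientGroup.lift _ ψ hker).comp f.toMonoidHom, fun x g => ?_, fun e => ?_⟩
  · rw [← hv]
    simp [vertexHom, vertexElem]
  · rw [← he]
    simp [stableLetter]

end UniversalProperty

section Injectivity

/-- Left multiplication on the first factor. -/
def leftPerm (K X : Type*) [Group K] : K →* Equiv.Perm (K × X) where
  toFun k := (Equiv.mulLeft k).prodCongr (Equiv.refl X)
  map_one' := by ext x <;> simp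
  map_mul' a b := by ext x <;> simp [mul_assoc]

theorem leftPerm_injective (K X : Type*) [Group K] [Nonempty X] :
    Function.Injective (leftPerm K X) := fun a b h => by
  obtain ⟨x⟩ := ‹Nonempty X›
  simpa [leftPerm] using congrArg Prod.fst (Equiv.congr_fun h (1, x))

/-- Up to isomorphism, the action of a subgroup of `K` on `K × (ℕ → K)` does not depend on the
subgroup. -/
theorem exists_equivariant_equiv {H K : Type*} [Group H] [Group K] {j : H →* K}
    (hj : Function.Injective j) :
    ∃ θ : H × (ℕ → K) ≃ K × (ℕ → K), ∀ g h x, θ (g * h, x) = leftPerm K _ (j g) (θ (h, x)) := by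
  let Q := Quotient (QuotientGroup.rightRel j.range)
  let α : H × Q ≃ K := Equiv.ofBijective (fun z => j z.1 * z.2.out) (by
    constructor
    · rintro ⟨g, q⟩ ⟨g', q'⟩ h
      have hq : q = q' := by
        rw [← Quotient.out_eq q, ← Quotient.out_eq q']
        refine Quotient.sound (QuotientGroup.rightRel_apply.2 ⟨g'⁻¹ * g, ?_⟩)
        rw [map_mul, map_inv, inv_mul_eq_iff_eq_mul, ← mul_assoc, eq_mul_inv_iff_mul_eq]
        exact h
      subst hq
      exact Prod.ext (hj (mul_right_cancel h)) rfl
    · intro k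
      obtain ⟨g, hg⟩ : k * (Quotient.mk (QuotientGroup.rightRel j.range) k).out⁻¹ ∈ j.range :=
        QuotientGroup.rightRel_apply.1 (Quotient.mk_out (s := QuotientGroup.rightRel j.range) k)
      exact ⟨(g, Quotient.mk _ k), by simp [hg]⟩)
  -- `K` is `H × Q` as an `H`-set, with `Q` the set of right cosets. The factor `ℕ → K` absorbs `Q`
  -- by Schröder–Bernstein, which erases the dependence on the embedding.
  obtain ⟨β⟩ : Nonempty (Q × (ℕ → K) ≃ (ℕ → K)) := by
    refine Function.Embedding.antisymm
      ⟨fun z n => Nat.casesOn n z.1.out z.2, ?_⟩ ⟨fun x => (Quotient.mk _ 1, x), ?_⟩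
    · rintro ⟨q, x⟩ ⟨q', x'⟩ h
      refine Prod.ext (Quotient.out_injective (congrFun h 0)) (funext fun n => congrFun h (n + 1))
    · intro x x' h
      exact congrArg Prod.snd h
  refine ⟨((Equiv.refl H).prodCongr β.symm).trans
    ((Equiv.prodAssoc H Q (ℕ → K)).symm.trans (α.prodCongr (Equiv.refl _))), fun g h x => ?_⟩
  have hα : ∀ z, α z = j z.1 * z.2.out := fun _ => rfl
  simp [leftPerm, hα, mul_assoc]

/-- Isomorphic subgroups of `K` become conjugate in the permutations of `K × (ℕ → K)`. -/
theorem exists_conj_leftPerm {H K : Type*} [Group H] [Group K] {j₁ j₂ : H →* K}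
    (h₁ : Function.Injective j₁) (h₂ : Function.Injective j₂) :
    ∃ t : Equiv.Perm (K × (ℕ → K)), ∀ g,
      t * leftPerm K _ (j₂ g) * t⁻¹ = leftPerm K _ (j₁ g) := by
  obtain ⟨θ₁, hθ₁⟩ := exists_equivariant_equiv h₁
  obtain ⟨θ₂, hθ₂⟩ := exists_equivariant_equiv h₂
  refine ⟨θ₂.symm.trans θ₁, fun g => ?_⟩
  rw [mul_inv_eq_iff_eq_mul]
  ext1 z
  obtain ⟨⟨h, x⟩, rfl⟩ := θ₂.surjective z
  simp [← hθ₁, ← hθ₂]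

variable {G} {T : Set E} {Γ : Type*} [Group Γ] (f : Γ ≃* G.fundamentalGroup T)

/-- The vertex groups of a graph of groups embed into its fundamental group. -/
theorem vertexHom_injective [Finite E] (hT : G.IsMaximalTree T) (x : V) :
    Function.Injective (vertexHom f x) := by
  classical
  -- All vertex groups embed in one group `K`, so each edge relation can be realised by a
  -- permutation `t e` of `K × (ℕ → K)`.
  let K := ∀ x, G.vertexGroup x
  let j : ∀ x, G.vertexGroup x →* K := fun x => MonoidHom.mulSingle _ x
  have hj : ∀ x, Function.Injective (j x) := fun x => Pi.mulSingle_injective x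
  have := fun e => exists_conj_leftPerm
    (j₁ := (j _).comp (G.srcHom e)) (j₂ := (j _).comp (G.tgtHom e))
    ((hj (G.src e)).comp (G.srcHom_injective e)) ((hj (G.tgt e)).comp (G.tgtHom_injective e))
  choose t ht using this
  -- Stable letters of tree edges must act trivially. Conjugating the action of the vertex group at
  -- `x` by `c x` turns `t e` into `c (src e) t_e c (tgt e)⁻¹`, which is 1 on the tree.
  obtain ⟨c, hc⟩ := G.exists_potential t T.toFinite hT.acyclic
  obtain ⟨Φ, hΦ, -⟩ := exists_hom f
    (fun x => (MulAut.conj (c x)).toMonoidHom.comp ((leftPerm K _).comp (j x)))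
    (fun e => c (G.src e) * t e * (c (G.tgt e))⁻¹)
    (fun e a => by
      have h := ht e a
      simp only [MonoidHom.comp_apply] at h
      simp only [MonoidHom.comp_apply, MulEquiv.coe_toMonoidHom, MulAut.conj_apply, ← h]
      group)
    (fun e he => by rw [hc e he, mul_inv_cancel])
  refine Function.Injective.of_comp (f := Φ) ?_
  have : (Φ ∘ vertexHom f x) = MulAut.conj (c x) ∘ leftPerm K _ ∘ j x := funext (hΦ x)
  rw [this]
  exact (MulAut.conj (c x)).injective.comp ((leftPerm_injective _ _).comp (hj x))

end Injectivity

end GraphOfGroups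

/-! ### Direct sums of permutation modules -/

section PermutationModule

variable (R : Type u) [Ring R] {Γ : Type u} [Group Γ]

/-- A group element in the group ring. -/
abbrev groupElem (γ : Γ) : MonoidAlgebra R Γ := MonoidAlgebra.single γ 1

theorem groupElem_mul (γ δ : Γ) : groupElem R (γ * δ) = groupElem R γ * groupElem R δ := by simp

theorem groupElem_one : groupElem R (1 : Γ) = 1 := rfl

variable {R}

theorem groupElem_mul_smul {M : Type*} [AddCommGroup M] [Module (MonoidAlgebra R Γ) M] (γ δ : Γ)
    (x : M) : groupElem R (γ * δ) • x = groupElem R γ • groupElem R δ • x := by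
  rw [groupElem_mul, mul_smul]

theorem groupElem_inv_smul_eq {M : Type*} [AddCommGroup M] [Module (MonoidAlgebra R Γ) M] {γ : Γ}
    {x y : M} (h : groupElem R γ • x = y) : groupElem R γ⁻¹ • y = x := by
  rw [← h, ← groupElem_mul_smul, inv_mul_cancel, groupElem_one, one_smul]

/-- The `RΓ`-module `B` is free on generators `b v` fixed by the subgroups `Δ v`. -/
structure IsPermutationModule {V : Type v} (Δ : V → Subgroup Γ) {B : Type u} [AddCommGroup B]
    [Module (MonoidAlgebra R Γ) B] (b : V → B) : Prop where
  fixed : ∀ v, ∀ h ∈ Δ v, groupElem R h • b v = b v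
  lift : ∀ (M : Type u) [AddCommGroup M] [Module (MonoidAlgebra R Γ) M] (m : V → M),
    (∀ v, ∀ h ∈ Δ v, groupElem R h • m v = m v) →
      ∃ p : B →ₗ[MonoidAlgebra R Γ] M, ∀ v, p (b v) = m v
  span : Submodule.span (MonoidAlgebra R Γ) (Set.range b) = ⊤

variable (R) in
/-- The permutation module `R[Γ/Δ]`. -/
def InducedTrivial (Δ : Subgroup Γ) : Type u :=
  InducedModule (subgroupRingHom R Δ) (trivialModule R Δ)

instance (Δ : Subgroup Γ) : AddCommGroup (InducedTrivial R Δ) :=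
  inferInstanceAs (AddCommGroup (InducedModule (subgroupRingHom R Δ) (trivialModule R Δ)))

instance (Δ : Subgroup Γ) : Module (MonoidAlgebra R Γ) (InducedTrivial R Δ) :=
  inferInstanceAs (Module (MonoidAlgebra R Γ)
    (InducedModule (subgroupRingHom R Δ) (trivialModule R Δ)))

variable (R) in
/-- The generator of the permutation module `R[Γ/Δ]`. -/
def InducedTrivial.gen (Δ : Subgroup Γ) : InducedTrivial R Δ := inducedGen R Δ

theorem InducedTrivial.smul_gen {Δ : Subgroup Γ} {h : Γ} (hh : h ∈ Δ) :
    groupElem R h • gen R Δ = gen R Δ :=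
  single_smul_inducedGen R hh

theorem InducedTrivial.exists_hom {Δ : Subgroup Γ} {M : Type u} [AddCommGroup M]
    [Module (MonoidAlgebra R Γ) M] {m : M} (hm : ∀ h ∈ Δ, groupElem R h • m = m) :
    ∃ p : InducedTrivial R Δ →ₗ[MonoidAlgebra R Γ] M, p (gen R Δ) = m :=
  exists_inducedTrivial_hom hm

theorem InducedTrivial.exists_smul_gen {Δ : Subgroup Γ} (x : InducedTrivial R Δ) :
    ∃ a : MonoidAlgebra R Γ, a • gen R Δ = x := by
  refine inducedModule_induction (subgroupRingHom R Δ) (M := trivialModule R Δ)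
    (p := fun x => ∃ a : MonoidAlgebra R Γ, a • inducedGen R Δ = x) ⟨0, zero_smul _ _⟩ ?_ ?_ x
  · rintro _ _ ⟨a, rfl⟩ ⟨b, rfl⟩
    exact ⟨a + b, add_smul _ _ _⟩
  · intro a y
    obtain ⟨y, rfl⟩ := (trivialEquiv R Δ).surjective y
    exact ⟨_, (inducedMk_trivialEquiv R Δ a y).symm⟩

variable (R) in
/-- The generator `Δ i` of the direct sum of the permutation modules `R[Γ/Δ i]`. -/
def piInducedGen {l : ℕ} (Δ : Fin l → Subgroup Γ) (i : Fin l) : ∀ i, InducedTrivial R (Δ i) :=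
  Pi.single i (InducedTrivial.gen R (Δ i))

theorem isPermutationModule_pi {l : ℕ} (Δ : Fin l → Subgroup Γ) :
    IsPermutationModule (R := R) Δ (piInducedGen R Δ) where
  fixed i h hh := by
    rw [piInducedGen, ← Pi.single_smul, InducedTrivial.smul_gen hh]
  lift M _ _ m hm := by
    have := fun i => InducedTrivial.exists_hom (hm i)
    choose p hp using this
    exact ⟨LinearMap.lsum _ _ ℕ p, fun i => by
      rw [piInducedGen, LinearMap.lsum_piSingle, hp]⟩
  span := by
    refine top_unique fun x _ => ?_
    rw [← Finset.univ_sum_single x]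
    refine Submodule.sum_mem _ fun i _ => ?_
    obtain ⟨a, ha⟩ := InducedTrivial.exists_smul_gen (x i)
    rw [← ha, Pi.single_smul]
    exact Submodule.smul_mem _ _ (Submodule.subset_span ⟨i, rfl⟩)

theorem IsPermutationModule.comp_equiv {V V' : Type*} {Δ : V → Subgroup Γ} {B : Type u}
    [AddCommGroup B] [Module (MonoidAlgebra R Γ) B] {b : V → B} (h : IsPermutationModule (R := R) Δ b)
    (e : V' ≃ V) : IsPermutationModule (R := R) (Δ ∘ e) (b ∘ e) where
  fixed v := h.fixed (e v)
  lift M _ _ m hm := by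
    obtain ⟨p, hp⟩ := h.lift M (m ∘ e.symm) fun v => by simpa using hm (e.symm v)
    exact ⟨p, fun v => by simp [hp]⟩
  span := by rw [e.surjective.range_comp, h.span]

/-- `V` lives in its own universe, so the sum is indexed by `Fin l`. The resolution statement is
part of the conclusion because the module is otherwise known only through its universal property. -/
theorem exists_isPermutationModule {V : Type v} [Finite V] (Δ : V → Subgroup Γ) :
    ∃ (B : Type u) (_ : AddCommGroup B) (_ : Module (MonoidAlgebra R Γ) B) (b : V → B),
      IsPermutationModule (R := R) Δ b ∧
      ∀ {C : ISClass.{u}} {E : ∀ (Γ : Type u) [Group Γ], ℤ →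
        ChainComplex (ModuleCat.{u} (MonoidAlgebra R Γ)) ℤ → Prop} {n : ℤ},
        IsEquivariantlyBootstrappable R C E → C.Mem Γ → Nonempty V →
        (∀ v, HasResolutionIn (E (Δ v)) n (trivialModule R (Δ v))) → HasResolutionIn (E Γ) n B := by
  obtain ⟨l, ⟨e⟩⟩ := Finite.exists_equiv_fin V
  have h := (isPermutationModule_pi (R := R) (Δ ∘ e.symm)).comp_equiv e
  have hΔ : (Δ ∘ e.symm) ∘ e = Δ := by
    ext1 v
    simp
  rw [hΔ] at h
  refine ⟨_, _, _, _, h, fun {C E n} hE hΓ ⟨v⟩ hV => ?_⟩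
  cases l with
  | zero => exact (e v).elim0
  | succ l =>
    exact (hE.bootstrappable Γ hΓ).hasResolutionIn_pi l _ fun i =>
      hE.hasResolutionIn_induced R _ hΓ (hV (e.symm i))

end PermutationModule

/-! ### Coinduced modules and vanishing of first cohomology -/

section CoinducedModule

/-- The `S`-module coinduced from the additive group `A`. -/
def CoinducedModule (S A : Type*) [Ring S] [AddCommGroup A] := S →+ A

variable {S A : Type*} [Ring S] [AddCommGroup A]

instance : AddCommGroup (CoinducedModule S A) := inferInstanceAs (AddCommGroup (S →+ A))

instance : FunLike (CoinducedModule S A) S A := inferInstanceAs (FunLike (S →+ A) S A)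

instance : AddMonoidHomClass (CoinducedModule S A) S A :=
  inferInstanceAs (AddMonoidHomClass (S →+ A) S A)

@[ext]
theorem CoinducedModule.ext {φ ψ : CoinducedModule S A} (h : ∀ x, φ x = ψ x) : φ = ψ :=
  DFunLike.ext _ _ h

theorem CoinducedModule.add_apply (φ ψ : CoinducedModule S A) (x : S) :
    (φ + ψ) x = φ x + ψ x := rfl

instance : SMul S (CoinducedModule S A) :=
  ⟨fun s φ => AddMonoidHom.comp (φ : S →+ A) (AddMonoidHom.mulRight s)⟩

theorem CoinducedModule.smul_apply (s : S) (φ : CoinducedModule S A) (x : S) :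
    (s • φ) x = φ (x * s) := rfl

instance : Module S (CoinducedModule S A) where
  one_smul φ := by ext x; rw [CoinducedModule.smul_apply, mul_one]
  mul_smul s t φ := by ext x; simp only [CoinducedModule.smul_apply, mul_assoc]
  smul_zero _ := rfl
  smul_add _ _ _ := rfl
  add_smul s t φ := by
    ext x
    rw [CoinducedModule.add_apply, CoinducedModule.smul_apply, mul_add, map_add]
    rfl
  zero_smul φ := by
    ext x
    rw [CoinducedModule.smul_apply, mul_zero, map_zero]
    rfl

/-- The embedding of an `S`-module into a coinduced module. -/
def toCoinduced (S : Type*) {A : Type*} [Ring S] [AddCommGroup A] [Module S A] :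
    A →ₗ[S] CoinducedModule S A where
  toFun a := (AddMonoidHom.mk' (fun s => s • a) fun s t => add_smul s t a : S →+ A)
  map_add' a b := CoinducedModule.ext fun s => smul_add s a b
  map_smul' s a := CoinducedModule.ext fun t => (mul_smul t s a).symm

theorem toCoinduced_injective [Module S A] : Function.Injective (toCoinduced S (A := A)) :=
  fun a b h => by
    have h1 : (1 : S) • a = (1 : S) • b := DFunLike.congr_fun h 1
    rwa [one_smul, one_smul] at h1

/-- Derivations of a group with values in a coinduced module are inner. -/
theorem CoinducedModule.exists_of_derivation {R Γ A : Type*} [Ring R] [Group Γ] [AddCommGroup A]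
    (δ : Γ → CoinducedModule (MonoidAlgebra R Γ) A)
    (hδ : ∀ γ γ', δ (γ * γ') = (MonoidAlgebra.single γ 1 : MonoidAlgebra R Γ) • δ γ' + δ γ) :
    ∃ F : CoinducedModule (MonoidAlgebra R Γ) A, ∀ γ,
      (MonoidAlgebra.single γ 1 : MonoidAlgebra R Γ) • F + δ γ = F := by
  -- With `(γ • F)(x) = F(xγ)`, the cocycle identity for `δ (xγ)` evaluated at the identity element
  -- is the equation sought.
  let F' : MonoidAlgebra R Γ →+ A := (Finsupp.liftAddHom fun x =>
    -((δ x : MonoidAlgebra R Γ →+ A).comp (MonoidAlgebra.singleAddHom 1))).comp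
      MonoidAlgebra.coeffAddEquiv.toAddMonoidHom
  let F : CoinducedModule (MonoidAlgebra R Γ) A := F'
  have hF : ∀ x r, F (MonoidAlgebra.single x r) = -δ x (MonoidAlgebra.single 1 r) := by
    intro x r
    change F' _ = _
    simp [F']
    rfl
  refine ⟨F, fun γ => ?_⟩
  have : (((MonoidAlgebra.single γ 1 : MonoidAlgebra R Γ) • F + δ γ :
      CoinducedModule (MonoidAlgebra R Γ) A) : MonoidAlgebra R Γ →+ A) = F' := by
    refine MonoidAlgebra.addMonoidHom_ext fun x r => ?_
    change F (MonoidAlgebra.single x r * MonoidAlgebra.single γ 1) +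
      δ γ (MonoidAlgebra.single x r) = F (MonoidAlgebra.single x r)
    rw [MonoidAlgebra.single_mul_single, mul_one, hF, hF, hδ, CoinducedModule.add_apply,
      CoinducedModule.smul_apply, MonoidAlgebra.single_mul_single, mul_one, one_mul]
    abel
  exact this

end CoinducedModule

/-! ### Affine permutations -/

section Affine

variable {R Γ M : Type*} [Ring R] [Group Γ] [AddCommGroup M] [Module (MonoidAlgebra R Γ) M]

/-- The affine permutation `x ↦ γ x + c`. -/
def affinePerm (R : Type*) {Γ M : Type*} [Ring R] [Group Γ] [AddCommGroup M]
    [Module (MonoidAlgebra R Γ) M] (γ : Γ) (c : M) : Equiv.Perm M where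
  toFun x := (MonoidAlgebra.single γ 1 : MonoidAlgebra R Γ) • x + c
  invFun x := (MonoidAlgebra.single γ⁻¹ 1 : MonoidAlgebra R Γ) • (x - c)
  left_inv x := by
    dsimp only
    rw [add_sub_cancel_right, ← mul_smul, MonoidAlgebra.single_mul_single, inv_mul_cancel, one_mul,
      ← MonoidAlgebra.one_def, one_smul]
  right_inv x := by
    dsimp only
    rw [← mul_smul, MonoidAlgebra.single_mul_single, mul_inv_cancel, one_mul,
      ← MonoidAlgebra.one_def, one_smul, sub_add_cancel]

theorem affinePerm_apply (γ : Γ) (c x : M) :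
    affinePerm R γ c x = (MonoidAlgebra.single γ 1 : MonoidAlgebra R Γ) • x + c := rfl

theorem affinePerm_mul (γ δ : Γ) (c d : M) : affinePerm R γ c * affinePerm R δ d =
    affinePerm R (γ * δ) ((MonoidAlgebra.single γ 1 : MonoidAlgebra R Γ) • d + c) := by
  ext x
  rw [Equiv.Perm.mul_apply, affinePerm_apply, affinePerm_apply, affinePerm_apply, smul_add,
    ← mul_smul, MonoidAlgebra.single_mul_single, one_mul, add_assoc]

theorem affinePerm_one : affinePerm R (1 : Γ) (0 : M) = 1 := by
  ext x
  rw [affinePerm_apply, ← MonoidAlgebra.one_def, one_smul, add_zero, Equiv.Perm.one_apply]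

theorem affinePerm_inv (γ : Γ) (c : M) : (affinePerm R γ c)⁻¹ =
    affinePerm R γ⁻¹ (-(MonoidAlgebra.single γ⁻¹ 1 : MonoidAlgebra R Γ) • c) := by
  rw [inv_eq_iff_mul_eq_one, affinePerm_mul, mul_inv_cancel, neg_smul, smul_neg, ← mul_smul,
    MonoidAlgebra.single_mul_single, mul_inv_cancel, one_mul, ← MonoidAlgebra.one_def, one_smul,
    neg_add_cancel, affinePerm_one]

end Affine

/-! ### The chain complex of the Bass–Serre tree -/

namespace GraphOfGroups

variable {V : Type v} {E : Type w} {G : GraphOfGroups.{u, v, w} V E} {T : Set E}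
  {R Γ : Type u} [Ring R] [Group Γ] (f : Γ ≃* G.fundamentalGroup T)

/-- The image of a vertex group in the fundamental group. -/
def vertexSubgroup (x : V) : Subgroup Γ := (vertexHom f x).range

/-- The image of an edge group in the fundamental group, embedded through the source. -/
def edgeSubgroup (e : E) : Subgroup Γ := ((vertexHom f (G.src e)).comp (G.srcHom e)).range

theorem edgeSubgroup_le (e : E) : edgeSubgroup f e ≤ vertexSubgroup f (G.src e) := by
  rintro _ ⟨a, rfl⟩
  exact ⟨_, rfl⟩

/-- In the tree this says that the stabiliser of an edge fixes its far endpoint, the translate by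
the stable letter of the vertex at `tgt e`; it makes the boundary map well defined. -/
theorem mul_stableLetter {e : E} {h : Γ} (hh : h ∈ edgeSubgroup f e) :
    ∃ k ∈ vertexSubgroup f (G.tgt e), h * stableLetter f e = stableLetter f e * k := by
  obtain ⟨a, rfl⟩ := hh
  refine ⟨_, ⟨G.tgtHom e a, rfl⟩, ?_⟩
  rw [MonoidHom.comp_apply, ← stableLetter_conj, inv_mul_cancel_right]

theorem sub_eq_sub_of_add_sub_eq {M : Type*} [AddCommGroup M] {x y z c : M}
    (h : x + (c - y) = z) : x - y = z - c := by
  rw [← h]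
  abel

theorem sub_sub_sub_eq_of_add_sub_sub_eq {M : Type*} [AddCommGroup M] {x y z c m : M}
    (h : x + (c - y - m) = z) : x - y - (z - c) = m := by
  rw [← h]
  abel

/-- Invariant elements of a coinduced module indexed by the edges are coboundaries of invariant
elements indexed by the vertices. -/
theorem exists_coboundary [Finite E] (hT : G.IsMaximalTree T) {A : Type*} [AddCommGroup A]
    (m : E → CoinducedModule (MonoidAlgebra R Γ) A)
    (hm : ∀ e, ∀ h ∈ edgeSubgroup f e, groupElem R h • m e = m e) :
    ∃ F : V → CoinducedModule (MonoidAlgebra R Γ) A,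
      (∀ x, ∀ h ∈ vertexSubgroup f x, groupElem R h • F x = F x) ∧
      ∀ e, groupElem R (stableLetter f e) • F (G.tgt e) - F (G.src e) = m e := by
  obtain ⟨c', hc'⟩ := G.exists_potential (fun e => Multiplicative.ofAdd (-m e)) T.toFinite
    hT.acyclic
  let c : V → CoinducedModule (MonoidAlgebra R Γ) A := fun x => (c' x).toAdd
  have hc : ∀ e ∈ T, c (G.src e) - m e = c (G.tgt e) := fun e he => by
    rw [sub_eq_add_neg]
    exact congrArg Multiplicative.toAdd (hc' e he)
  -- Vertex groups act linearly about the origin `c x`; the stable letter acts by `y ↦ t (y - c (tgt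
  -- e)) + c (src e) - m e`. The potential `c` is chosen so that this is the identity for tree
  -- edges.
  let φ : ∀ x, G.vertexGroup x →* Equiv.Perm (CoinducedModule (MonoidAlgebra R Γ) A) := fun x =>
    { toFun := fun g => affinePerm R (vertexHom f x g) (c x - groupElem R (vertexHom f x g) • c x)
      map_one' := by
        rw [map_one, groupElem_one, one_smul, sub_self, affinePerm_one]
      map_mul' := fun g h => by
        rw [affinePerm_mul, map_mul, groupElem_mul_smul, smul_sub]
        congr 1
        abel }
  let s : E → Equiv.Perm (CoinducedModule (MonoidAlgebra R Γ) A) := fun e =>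
    affinePerm R (stableLetter f e)
      (c (G.src e) - groupElem R (stableLetter f e) • c (G.tgt e) - m e)
  obtain ⟨Φ, hΦv, hΦe⟩ := exists_hom f φ s (fun e a => by
      have hrel := stableLetter_conj f e a
      rw [mul_inv_eq_iff_eq_mul] at hrel ⊢
      have hfix := hm e _ ⟨a, rfl⟩
      rw [MonoidHom.comp_apply] at hfix
      change affinePerm R _ _ * affinePerm R _ _ = affinePerm R _ _ * affinePerm R _ _
      rw [affinePerm_mul, affinePerm_mul, ← hrel]
      congr 1
      simp only [smul_sub, ← groupElem_mul_smul, ← hrel, hfix]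
      abel) (fun e he => by
      change affinePerm R _ _ = _
      rw [stableLetter_eq_one f he, groupElem_one, one_smul, ← hc e he]
      convert affinePerm_one (R := R) (Γ := Γ) using 2
      abel)
  -- The action is affine with the given linear part on generators, hence everywhere. Its
  -- translation part is a derivation, hence inner, which yields a global fixed point `F`; the
  -- vertex cochain is `F - c x`.
  have hlin : ∀ γ, ∃ d, Φ γ = affinePerm R γ d := by
    let K : Subgroup Γ :=
      { carrier := {γ | ∃ d, Φ γ = affinePerm R γ d}
        one_mem' := ⟨0, by rw [map_one, affinePerm_one]⟩
        mul_mem' := by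
          rintro γ γ' ⟨d, hd⟩ ⟨d', hd'⟩
          exact ⟨_, by rw [map_mul, hd, hd', affinePerm_mul]⟩
        inv_mem' := by
          rintro γ ⟨d, hd⟩
          exact ⟨_, by rw [map_inv, hd, affinePerm_inv]⟩ }
    have hK : K = ⊤ := eq_top_of_generators_mem f (fun x g => ⟨_, hΦv x g⟩) fun e => ⟨_, hΦe e⟩
    intro γ
    exact (hK ▸ Subgroup.mem_top γ : γ ∈ K)
  choose δ hδ using hlin
  have hΦ : ∀ γ x, Φ γ x = groupElem R γ • x + δ γ := fun γ x => by rw [hδ, affinePerm_apply]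
  obtain ⟨F, hF⟩ := CoinducedModule.exists_of_derivation δ fun γ γ' => by
    have h := hΦ (γ * γ') 0
    rw [map_mul, Equiv.Perm.mul_apply, hΦ, hΦ, smul_zero, zero_add, smul_zero, zero_add] at h
    exact h.symm
  have hfix : ∀ γ, Φ γ F = F := fun γ => by rw [hΦ, hF]
  refine ⟨fun x => F - c x, ?_, fun e => ?_⟩
  · rintro x _ ⟨g, rfl⟩
    have h := hfix (vertexHom f x g)
    rw [hΦv] at h
    change groupElem R _ • F + (c x - groupElem R _ • c x) = F at h
    rw [smul_sub]
    exact sub_eq_sub_of_add_sub_eq h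
  · have h := hfix (stableLetter f e)
    rw [hΦe] at h
    change groupElem R _ • F + (c (G.src e) - groupElem R _ • c (G.tgt e) - m e) = F at h
    rw [smul_sub]
    exact sub_sub_sub_eq_of_add_sub_sub_eq h

/-- `RΓ` acts through the augmentation on the `R`-multiples of a `Γ`-fixed element. -/
theorem smul_single_one_smul {M : Type*} [AddCommGroup M] [Module (MonoidAlgebra R Γ) M] {m : M}
    (hm : ∀ γ : Γ, groupElem R γ • m = m) (a : MonoidAlgebra R Γ) (r : R) :
    a • (MonoidAlgebra.single 1 r : MonoidAlgebra R Γ) • m =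
      (MonoidAlgebra.single 1 (augmentation R Γ a * r) : MonoidAlgebra R Γ) • m := by
  induction a using MonoidAlgebra.induction_linear with
  | zero => simp
  | add a b ha hb => rw [add_smul, ha, hb, map_add, add_mul, MonoidAlgebra.single_add, add_smul]
  | single γ s =>
    have : (MonoidAlgebra.single γ s : MonoidAlgebra R Γ) * MonoidAlgebra.single 1 r =
        MonoidAlgebra.single 1 (s * r) * groupElem R γ := by simp
    rw [← mul_smul, this, mul_smul, hm, augmentation_single]

/-- The augmented chain complex of the Bass–Serre tree of a graph of groups is exact. -/
theorem exists_exact_sequence [Finite E] (hT : G.IsMaximalTree T) {A B : Type u} [AddCommGroup A]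
    [Module (MonoidAlgebra R Γ) A] [AddCommGroup B] [Module (MonoidAlgebra R Γ) B] {a : E → A}
    {b : V → B} (ha : IsPermutationModule (R := R) (edgeSubgroup f) a)
    (hb : IsPermutationModule (R := R) (vertexSubgroup f) b) :
    ∃ (d : A →ₗ[MonoidAlgebra R Γ] B) (ε : B →ₗ[MonoidAlgebra R Γ] trivialModule R Γ),
      Function.Injective d ∧ Function.Exact d ε ∧ Function.Surjective ε := by
  obtain ⟨d, hd⟩ := ha.lift B
    (fun e => groupElem R (stableLetter f e) • b (G.tgt e) - b (G.src e)) fun e h hh => by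
      obtain ⟨k, hk, hhk⟩ := mul_stableLetter f hh
      rw [smul_sub, ← groupElem_mul_smul, hhk, groupElem_mul_smul, hb.fixed _ k hk,
        hb.fixed _ h (edgeSubgroup_le f e hh)]
  obtain ⟨ε, hε⟩ := hb.lift (trivialModule R Γ) (fun _ => trivialEquiv R Γ 1) fun _ h _ => by
    rw [single_smul_trivialEquiv, mul_one]
  refine ⟨d, ε, ?_, ?_, fun y => ?_⟩
  -- Writing the edge cochain of the embedding `ι` as a coboundary yields `ψ` with `ψ ∘ d = ι`, so
  -- `d` is injective because `ι` is.
  · let ι := toCoinduced (MonoidAlgebra R Γ) (A := A)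
    obtain ⟨F, hF, hFm⟩ := exists_coboundary f hT (fun e => ι (a e)) fun e h hh => by
      rw [← map_smul, ha.fixed e h hh]
    obtain ⟨ψ, hψ⟩ := hb.lift _ F hF
    have hψd : ψ ∘ₗ d = ι := LinearMap.ext_on_range ha.span fun e => by
      rw [LinearMap.comp_apply, hd, map_sub, map_smul, hψ, hψ, hFm]
    refine Function.Injective.of_comp (f := ψ) ?_
    rw [← LinearMap.coe_comp, hψd]
    exact toCoinduced_injective
  · obtain ⟨x₀⟩ := G.nonempty
    let q := (LinearMap.range d).mkQ
    have hq : ∀ z, q z = 0 ↔ z ∈ LinearMap.range d := fun z => Submodule.Quotient.mk_eq_zero _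
    have hedge : ∀ e, groupElem R (stableLetter f e) • q (b (G.tgt e)) = q (b (G.src e)) :=
      fun e => by
        rw [← sub_eq_zero, ← map_smul, ← map_sub, hq]
        exact ⟨a e, hd e⟩
    -- In the cokernel of `d` all vertex generators agree along the tree, and their common value is
    -- fixed by the generators of `Γ`. So `q z` is determined by `ε z`.
    have hconst : ∀ x, q (b x) = q (b x₀) := fun x => by
      induction hT.joined x x₀ with
      | rel x y h =>
        obtain ⟨e, he, rfl, rfl⟩ := h
        rw [← hedge, stableLetter_eq_one f he, groupElem_one, one_smul]
      | refl x => rfl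
      | symm x y _ h => exact h.symm
      | trans x y z _ _ h h' => exact h.trans h'
    have hfix : ∀ γ : Γ, groupElem R γ • q (b x₀) = q (b x₀) := by
      let K : Subgroup Γ :=
        { carrier := {γ | groupElem R γ • q (b x₀) = q (b x₀)}
          one_mem' := one_smul _ _
          mul_mem' := fun {γ γ'} h h' => by
            rw [Set.mem_ofPred_eq, groupElem_mul_smul, h', h]
          inv_mem' := fun h => groupElem_inv_smul_eq h }
      have hK : K = ⊤ := eq_top_of_generators_mem f
        (fun x g => by
          change groupElem R _ • q (b x₀) = q (b x₀)
          rw [← hconst x, ← map_smul, hb.fixed x _ ⟨g, rfl⟩])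
        fun e => by
          have h := hedge e
          rwa [hconst (G.tgt e), hconst (G.src e)] at h
      intro γ
      exact (hK ▸ Subgroup.mem_top γ : γ ∈ K)
    have key : ∀ z, q z = (MonoidAlgebra.single 1 ((trivialEquiv R Γ).symm (ε z)) :
        MonoidAlgebra R Γ) • q (b x₀) := fun z => by
      have hz : z ∈ Submodule.span (MonoidAlgebra R Γ) (Set.range b) := hb.span ▸ Submodule.mem_top
      induction hz using Submodule.span_induction with
      | mem z hz =>
        obtain ⟨x, rfl⟩ := hz
        rw [hε, AddEquiv.symm_apply_apply, hfix, hconst]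
      | zero => simp
      | add y z _ _ hy hz => rw [map_add, hy, hz, map_add, map_add, MonoidAlgebra.single_add, add_smul]
      | smul c z _ hz =>
        obtain ⟨r, hr⟩ := (trivialEquiv R Γ).surjective (ε z)
        rw [← hr, AddEquiv.symm_apply_apply] at hz
        rw [map_smul, map_smul, hz, smul_single_one_smul hfix, ← hr, smul_trivialEquiv,
          AddEquiv.symm_apply_apply]
    intro z
    constructor
    · intro hz
      exact (hq z).1 (by rw [key, hz, map_zero, MonoidAlgebra.single_zero, zero_smul])
    · rintro ⟨y, rfl⟩
      have : ε ∘ₗ d = 0 := LinearMap.ext_on_range ha.span fun e => by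
        rw [LinearMap.comp_apply, hd, map_sub, map_smul, hε, hε, single_smul_trivialEquiv, mul_one,
          sub_self, LinearMap.zero_apply]
      exact LinearMap.congr_fun this y
  · obtain ⟨x₀⟩ := G.nonempty
    obtain ⟨r, rfl⟩ := (trivialEquiv R Γ).surjective y
    exact ⟨(MonoidAlgebra.single 1 r : MonoidAlgebra R Γ) • b x₀, by
      rw [map_smul, hε, single_smul_trivialEquiv, mul_one]⟩

/-- Bootstrappable properties pass from the vertex and edge groups of a finite graph of groups to
its fundamental group. -/
theorem hasResolutionIn_of_graphOfGroups [Finite V] [Finite E] (hT : G.IsMaximalTree T)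
    {C : ISClass.{u}} {P : ∀ (Γ : Type u) [Group Γ], ℤ →
      ChainComplex (ModuleCat.{u} (MonoidAlgebra R Γ)) ℤ → Prop}
    (hP : IsEquivariantlyBootstrappable R C P) (hΓ : C.Mem Γ) {n : ℤ}
    (hV : ∀ x, HasResolutionIn (P (vertexSubgroup f x)) n (trivialModule R (vertexSubgroup f x)))
    (hE : ∀ e, HasResolutionIn (P (edgeSubgroup f e)) (n - 1)
      (trivialModule R (edgeSubgroup f e))) :
    HasResolutionIn (P Γ) n (trivialModule R Γ) := by
  obtain ⟨A, _, _, a, ha, hA⟩ := exists_isPermutationModule (R := R) (edgeSubgroup f)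
  obtain ⟨B, _, _, b, hb, hB⟩ := exists_isPermutationModule (R := R) (vertexSubgroup f)
  obtain ⟨d, ε, hd, hdε, hε⟩ := exists_exact_sequence f hT ha hb
  have hB' := hB hP hΓ G.nonempty hV
  -- Without edges the kernel is the zero module, whose membership is not guaranteed; but then `ε`
  -- is an isomorphism.
  rcases isEmpty_or_nonempty E with hE' | hE'
  · have hd0 : ∀ x, d x = 0 := fun x => by
      have : d = 0 := LinearMap.ext_on_range ha.span fun e => hE'.elim e
      rw [this, LinearMap.zero_apply]
    have hinj : Function.Injective ε := (injective_iff_map_eq_zero ε).2 fun y hy => by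
      obtain ⟨x, rfl⟩ := (hdε y).1 hy
      exact hd0 x
    exact hB'.of_linearEquiv (LinearEquiv.ofBijective ε ⟨hinj, hε⟩)
  · exact (hP.bootstrappable Γ hΓ).hasResolutionIn_of_exact hd hdε hε (hA hP hΓ hE' hE) hB'

end GraphOfGroups

end

/-! ### The theorem -/

theorem mainTheorem8 {R : Type u} [Ring R] (C : ISClass.{u}) (B : ℤ → GroupClass.{u})
    (hB : IsBootstrappableOfGroups R C B) (n : ℤ) :
    -- (i) graphs of groups
    (∀ (V : Type v) (E : Type w) [Finite V] [Finite E] (G : GraphOfGroups.{u, v, w} V E)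
      (T : Set E), G.IsMaximalTree T → ∀ (Γ : Type u) [Group Γ], C.Mem Γ →
      Nonempty (Γ ≃* G.fundamentalGroup T) →
      (∀ x, (B n).Mem (G.vertexGroup x)) → (∀ e, (B (n - 1)).Mem (G.edgeGroup e)) →
      (B n).Mem Γ) ∧
    -- (ii) extensions
    (∀ (Γ : Type u) [Group Γ] (N : Subgroup Γ) [N.Normal], C.Mem Γ → IsOfTypeFP R n (Γ ⧸ N) →
      (∀ m : ℤ, m ≤ n → (B m).Mem N) → (B n).Mem Γ) ∧
    -- the criterion for the hypothesis of (ii)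
    (∀ (Γ : Type u) [Group Γ] (N : Subgroup Γ) [N.Normal], IsOfTypeFP R n Γ →
      IsOfTypeFP R (n - 1) N → IsOfTypeFP R n (Γ ⧸ N)) ∧
    -- (iii) finite extensions
    (∀ (Γ : Type u) [Group Γ] (N : Subgroup Γ) [N.Normal], C.Mem Γ → N.FiniteIndex →
      (∀ m : ℤ, m ≤ n → (B m).Mem N) → (B n).Mem Γ) ∧
    -- (iv) finitely generated free abelian groups
    (∀ (Γ : Type u) [Group Γ], C.Mem Γ → Nontrivial Γ → IsFGFreeAbelian Γ →
      (∀ m : ℤ, m ≤ n → (B m).Mem (ULift.{u} (Multiplicative ℤ))) → (B n).Mem Γ) ∧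
    -- (v) groups containing a free abelian normal subgroup
    (∀ (Γ : Type u) [Group Γ], C.Mem Γ → IsOfTypeFP R n Γ →
      (∃ N : Subgroup Γ, N.Normal ∧ Nontrivial N ∧ IsFGFreeAbelian N) →
      (∀ m : ℤ, m ≤ n → (B m).Mem (ULift.{u} (Multiplicative ℤ))) → (B n).Mem Γ) := by
  obtain ⟨E', hE, hBE⟩ := hB
  have extension : ∀ (Γ : Type u) [Group Γ] (N : Subgroup Γ) [N.Normal], C.Mem Γ →
      IsOfTypeFP R n (Γ ⧸ N) → (∀ m : ℤ, m ≤ n → (B m).Mem N) → (B n).Mem Γ :=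
    fun Γ _ N _ hΓ hQ hN => (hBE n Γ).2
      ⟨hΓ, hE.hasResolutionIn_of_extension hΓ N hQ fun m hm => ((hBE m N).1 (hN m hm)).2⟩
  -- Stated for all `m ≤ n`, since (v) feeds it into the extension theorem, which needs the normal
  -- subgroup in every degree up to `n`.
  have freeAbelian : ∀ (Γ : Type u) [Group Γ], C.Mem Γ → Nontrivial Γ → IsFGFreeAbelian Γ →
      ∀ m : ℤ, m ≤ n → (∀ l : ℤ, l ≤ n → (B l).Mem (ULift.{u} (Multiplicative ℤ))) →
      (B m).Mem Γ := by
    intro Γ _ hΓ hΓ' hfree m hm hZ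
    obtain ⟨k, ⟨e⟩⟩ := hfree
    obtain _ | k := k
    · exact absurd (e.injective.subsingleton) (not_subsingleton Γ)
    · obtain ⟨N, hN, ⟨e₁⟩, ⟨e₂⟩⟩ := exists_normal_mulEquiv_int e
      refine (hBE m Γ).2 ⟨hΓ, hE.hasResolutionIn_of_extension hΓ N
        (isOfTypeFP_of_mulEquiv_pi_int e₂ m) fun l hl => ((hBE l N).1 ?_).2⟩
      exact (B l).of_mulEquiv _ _ ⟨MulEquiv.ulift.trans e₁.symm⟩ (hZ l (hl.trans hm))
  refine ⟨?_, extension, fun Γ _ N _ hΓ hN => hΓ.quotient N hN, ?_,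
    fun Γ _ hΓ hΓ' hfree hZ => freeAbelian Γ hΓ hΓ' hfree n le_rfl hZ, ?_⟩
  · rintro V E _ _ G T hT Γ _ hΓ ⟨f⟩ hV hEd
    refine (hBE n Γ).2 ⟨hΓ, GraphOfGroups.hasResolutionIn_of_graphOfGroups f hT hE hΓ
      (fun x => ((hBE n _).1 ?_).2) fun e => ((hBE (n - 1) _).1 ?_).2⟩
    -- The hypotheses concern abstract vertex and edge groups; injectivity transports them to
    -- subgroups of `Γ`.
    · exact (B n).of_mulEquiv _ _
        ⟨MonoidHom.ofInjective (GraphOfGroups.vertexHom_injective f hT x)⟩ (hV x)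
    · refine (B (n - 1)).of_mulEquiv _ _ ⟨MonoidHom.ofInjective ?_⟩ (hEd e)
      exact (GraphOfGroups.vertexHom_injective f hT (G.src e)).comp (G.srcHom_injective e)
  · intro Γ _ N _ hΓ hfin hN
    have := Subgroup.finite_quotient_of_finiteIndex (H := N)
    exact extension Γ N hΓ (isOfTypeFP_of_finite n) hN
  · rintro Γ _ hΓ hFP ⟨N, hN, hN', hfree⟩ hZ
    refine extension Γ N hΓ (hFP.quotient N ?_) fun m hm =>
      freeAbelian N (C.of_subgroup Γ N hΓ) hN' hfree m hm hZ
    obtain ⟨k, ⟨e⟩⟩ := hfree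
    exact isOfTypeFP_of_mulEquiv_pi_int e (n - 1)
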